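/- Let $q\ge 0$, let $\Theta\subset\mathbb R^q$ be open, bounded and convex with closure $\Theta^c$, and let $\theta\in\Theta$. Consider the regression model $X(t)=a(t,\theta)+\varepsilon(t)$, $t\ge 0$, where $a$ is continuous on $[0,\infty)\times\Theta^c$ and $a(t,\cdot)\in C^1(\Theta)$ for every $t\ge 0$. For $T>0$ let $\theta_T$ be a least squares estimator, that is, a random vector with values in $\Theta^c$ that minimizes $\int_0^T(X(t)-a(t,\tau))^2\,dt$ over $\tau\in\Theta^c$. *Noise.* $\varepsilon=\{\varepsilon(t),t\in\mathbb R\}$ is a mean-square continuous and almost surely continuous process with $E\varepsilon(t)=0$. A process $\zeta$ on $\mathbb R$ is called jointly strictly sub-Gaussian if $E\exp\{\sum_i\Delta_i\zeta(t_i)\}\le\exp\{\frac12\sum_{i,j}\Delta_i\Delta_jE\zeta(t_i)\zeta(t_j)\}$ for all finite families $t_i,\Delta_i\in\mathbb R$. One of the following three conditions holds, which also fixes a number $d_0$: 1. $\varepsilon$ is jointly strictly sub-Gaussian, $d_0>0$, and $\int_0^T\!\int_0^T E[\varepsilon(t)\varepsilon(s)]\,\Delta(t)\Delta(s)\,dt\,ds\le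 d_0\int_0^T\Delta^2(t)\,dt$ for all $T>0$ and $\Delta\in L_2([0,T])$; 2. $\varepsilon$ is jointly strictly sub-Gaussian and (wide-sense) stationary with a bounded spectral density $f$, i.e. $E\varepsilon(0)\varepsilon(t)=\int_{\mathbb R}e^{i\lambda t}f(\lambda)\,d\lambda$, and $d_0=2\pi\sup_\lambda f(\lambda)$; 3. $\varepsilon(t)=\int_{-\infty}^t\psi(t-s)\,d\xi(s)$ (mean-square Stieltjes integral), where $\psi\in L_2(\mathbb R)$ vanishes on $(-\infty,0)$ and $\xi$ is a centred mean-square continuous jointly strictly sub-Gaussian process on $\mathbb R$ with orthogonal increments and $E|\xi(t+s)-\xi(t)|^2=s$ for $s>0$; the function $h(\lambda)=(2\pi)^{-1/2}\int_0^\infty\psi(t)e^{-i\lambda t}\,dt$ (in the $L_2(\mathbb R)$ sense) is bounded, and $d_0=2\pi\sup_\lambda|h(\lambda)|^2$. *Normalization.* There are diagonal matrices $s_T=\mathrm{diag}(s_{1T},\dots,s_{qT})$ and constants $0<\underline c_i<\overline c_i$ such that for all large $T$, all $\tau\in\Theta$ and all $i$, $\underline c_i<s_{iT}^{-1}d_{iT}(\tau)<\overline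 c_i$, where $d_{iT}^2(\tau)=\int_0^T(\partial a(t,\tau)/\partial\tau_i)^2\,dt$; moreover $\liminf_{T\to\infty}T^{-1/2}s_{iT}>0$ for every $i$. *Distinguishability.* There are $0<c_0<c_1<\infty$ such that for all large $T$ and all $u,v\in s_T(\Theta^c-\theta)$, $$c_0\|u-v\|^2\le\int_0^T\bigl(a(t,\theta+s_T^{-1}u)-a(t,\theta+s_T^{-1}v)\bigr)^2dt\le c_1\|u-v\|^2 .$$ Then for every $\beta>0$ there are constants $B>0$, $b>0$, $\kappa>0$, $T_0>0$ with $b\ge\frac{c_0}{8d_0(1+q)}-\beta$ (for $d_0=0$ the quotient is read as $0$) such that for every least squares estimator and every $T>T_0$: * for all $\rho>0$ and $\nu\in[0,\frac12)$, $\;P\{\|T^{-1/2}s_T(\theta_T-\theta)\|\ge\rho T^{-\nu}\}\le B\exp\{-b\rho^2T^{1-2\nu}\}$; * (moderate deviations) for all $h>0$, $\;P\{\|s_T(\theta_T-\theta)\|\ge h(\ln T)^{1/2}\}\le B\,T^{-bh^2}$; * (exponential consistency) for all $r>0$, $\;P\{\|\theta_T-\theta\|\ge r\}\le B\exp\{-\kappa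 r^2T\}$. -/

import Mathlib

open MeasureTheory Filter Topology Set

noncomputable section

namespace RegressionLSE

/-! ### Noise processes -/

section Noise

variable {Ω : Type*} [MeasurableSpace Ω]

/-- The covariance function `B(t, s) = E ε(t) ε(s)` of a centred process. -/
def covFun (P : Measure Ω) (ε : ℝ → Ω → ℝ) (t s : ℝ) : ℝ :=
  ∫ ω, ε t ω * ε s ω ∂P

/-- Strictly sub-Gaussian random vector: for every `Δ` the exponential moment
`E exp ⟨ξ, Δ⟩` is finite and at most `exp (⟨B Δ, Δ⟩ / 2)`, where `B(i, j) = E ξ_i ξ_j`. -/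
def IsStrictlySubGaussian (P : Measure Ω) {n : ℕ} (ξ : Fin n → Ω → ℝ) : Prop :=
  ∀ Δ : Fin n → ℝ,
    Integrable (fun ω => Real.exp (∑ i, ξ i ω * Δ i)) P ∧
    ∫ ω, Real.exp (∑ i, ξ i ω * Δ i) ∂P ≤
      Real.exp ((1 / 2) * ∑ i, ∑ j, (∫ ω, ξ i ω * ξ j ω ∂P) * Δ i * Δ j)

/-- Jointly strictly sub-Gaussian process on `ℝ`. -/
def IsJointlyStrictlySubGaussian (P : Measure Ω) (ξ : ℝ → Ω → ℝ) : Prop :=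
  ∀ (n : ℕ) (t : Fin n → ℝ), IsStrictlySubGaussian P (fun i => ξ (t i))

/-- Mean-square continuity of a process on `ℝ` (its values being square integrable). -/
def IsMeanSquareContinuous (P : Measure Ω) (ξ : ℝ → Ω → ℝ) : Prop :=
  (∀ t, MemLp (ξ t) 2 P) ∧
  ∀ t₀, Tendsto (fun t => ∫ ω, (ξ t ω - ξ t₀ ω) ^ 2 ∂P) (𝓝 t₀) (𝓝 0)

/-- Centred stochastic process, mean-square continuous and almost surely continuous. -/
structure IsContinuousCentredNoise (P : Measure Ω) (ε : ℝ → Ω → ℝ) : Prop where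
  measurable : ∀ t, Measurable (ε t)
  mean_square_continuous : IsMeanSquareContinuous P ε
  ae_continuous : ∀ᵐ ω ∂P, Continuous (fun t => ε t ω)
  mean_zero : ∀ t, ∫ ω, ε t ω ∂P = 0

/-- For all `T > 0` and `Δ ∈ L₂([0, T])`,
`∫₀ᵀ ∫₀ᵀ B(t, s) Δ(t) Δ(s) dt ds ≤ d₀ ∫₀ᵀ Δ(t)² dt`, where `d₀ > 0`. -/
def HasCovarianceBound (P : Measure Ω) (ε : ℝ → Ω → ℝ) (d₀ : ℝ) : Prop :=
  0 < d₀ ∧ ∀ T : ℝ, 0 < T → ∀ Δ : ℝ → ℝ, MemLp Δ 2 (volume.restrict (Icc 0 T)) →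
    (∫ t in (0 : ℝ)..T, ∫ s in (0 : ℝ)..T, covFun P ε t s * Δ t * Δ s) ≤
      d₀ * ∫ t in (0 : ℝ)..T, Δ t ^ 2

/-- (Wide-sense) stationarity of a centred process, with spectral density `f`:
`E ε(0) ε(t) = ∫ e^{iλt} f(λ) dλ`. -/
structure IsStationaryWithSpectralDensity (P : Measure Ω) (ε : ℝ → Ω → ℝ) (f : ℝ → ℝ) :
    Prop where
  stationary : ∀ t s h, covFun P ε (t + h) (s + h) = covFun P ε t s
  density_nonneg : ∀ l, 0 ≤ f l
  density_measurable : Measurable f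
  density_integrable : Integrable f
  spectral : ∀ t : ℝ, ((covFun P ε 0 t : ℝ) : ℂ) =
    ∫ l : ℝ, Complex.exp (Complex.I * (l : ℂ) * (t : ℂ)) * (f l : ℂ)

/-- Mean-square continuous jointly strictly sub-Gaussian centred process with orthogonal
increments and `E |ξ(t+s) - ξ(t)|² = s`. -/
structure IsSubGaussianOrthogonalIncrement (P : Measure Ω) (ξ : ℝ → Ω → ℝ) : Prop where
  measurable : ∀ t, Measurable (ξ t)
  mean_square_continuous : IsMeanSquareContinuous P ξ
  jointly_ssg : IsJointlyStrictlySubGaussian P ξ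
  mean_zero : ∀ t, ∫ ω, ξ t ω ∂P = 0
  orthogonal : ∀ t₁ t₂ t₃ t₄ : ℝ, t₁ < t₂ → t₂ ≤ t₃ → t₃ < t₄ →
    ∫ ω, (ξ t₂ ω - ξ t₁ ω) * (ξ t₄ ω - ξ t₃ ω) ∂P = 0
  increment_variance : ∀ t s : ℝ, 0 < s → ∫ ω, (ξ (t + s) ω - ξ t ω) ^ 2 ∂P = s

/-- A step function `∑ c_l 1_{[α_l, β_l)}` on `ℝ`, given by its finitely many pieces. -/
structure StepData where
  pieces : ℕ
  coeff : Fin pieces → ℝ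
  left : Fin pieces → ℝ
  right : Fin pieces → ℝ
  left_le_right : ∀ l, left l ≤ right l

/-- The function `∑ c_l 1_{[α_l, β_l)}`. -/
def StepData.toFun (σ : StepData) (s : ℝ) : ℝ :=
  ∑ l, σ.coeff l * (Ico (σ.left l) (σ.right l)).indicator (fun _ => (1 : ℝ)) s

/-- The elementary stochastic integral `∑ c_l (ξ(β_l) - ξ(α_l))`. -/
def StepData.integral (σ : StepData) (ξ : ℝ → Ω → ℝ) (ω : Ω) : ℝ :=
  ∑ l, σ.coeff l * (ξ (σ.right l) ω - ξ (σ.left l) ω)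

/-- `Y` is (a version of) the mean-square Stieltjes integral `∫ φ(s) dξ(s)` of `φ ∈ L₂(ℝ)`:
the `L₂(Ω)`-limit of the integrals of step functions that converge to `φ` in `L₂(ℝ)`.
For a process with orthogonal increments and `E |ξ(t+s) - ξ(t)|² = s` the limit exists and does
not depend on the approximating sequence, by the isometry property. -/
def IsMeanSquareIntegral (P : Measure Ω) (ξ : ℝ → Ω → ℝ) (φ : ℝ → ℝ) (Y : Ω → ℝ) : Prop :=
  ∃ σ : ℕ → StepData,
    Tendsto (fun m => eLpNorm (fun s => φ s - (σ m).toFun s) 2 volume) atTop (𝓝 0) ∧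
    Tendsto (fun m => eLpNorm (fun ω => Y ω - (σ m).integral ξ ω) 2 P) atTop (𝓝 0)

/-- `ε(t) = ∫_{-∞}^t ψ(t - s) dξ(s)` with `ψ ∈ L₂(ℝ)`, `ψ(t) = 0` for `t < 0`, and `ξ` a jointly
strictly sub-Gaussian process with orthogonal increments. -/
structure IsMovingAverage (P : Measure Ω) (ε ξ : ℝ → Ω → ℝ) (ψ : ℝ → ℝ) : Prop where
  driver : IsSubGaussianOrthogonalIncrement P ξ
  kernel_causal : ∀ t, t < 0 → ψ t = 0
  kernel_memLp : MemLp ψ 2 volume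
  representation : ∀ t, IsMeanSquareIntegral P ξ (fun s => ψ (t - s)) (ε t)

/-- `h` is (a version of) `λ ↦ (2π)^{-1/2} ∫₀^∞ ψ(t) e^{-iλt} dt`; since `ψ` is only square
integrable, the integral is the `L₂(ℝ)`-limit of the integrals over `[0, N]`. -/
def IsTransferFunction (ψ : ℝ → ℝ) (h : ℝ → ℂ) : Prop :=
  MemLp h 2 volume ∧
  Tendsto (fun N : ℝ => eLpNorm (fun l : ℝ => h l - ((Real.sqrt (2 * Real.pi))⁻¹ : ℂ) *
      ∫ t in (0 : ℝ)..N, (ψ t : ℂ) * Complex.exp (-(Complex.I * (l : ℂ) * (t : ℂ)))) 2 volume)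
    atTop (𝓝 0)

/-- The three admissible sets of conditions on the noise, with the corresponding constant `d₀`:
* `ε` is jointly strictly sub-Gaussian with covariance operators bounded by `d₀`;
* `ε` is jointly strictly sub-Gaussian and stationary with a bounded spectral density `f`, and
  `d₀ = 2π sup f`;
* `ε` is a moving average of a jointly strictly sub-Gaussian process with orthogonal increments
  whose transfer function `h` is bounded, and `d₀ = 2π sup |h|²`. -/
def NoiseCondition (P : Measure Ω) (ε : ℝ → Ω → ℝ) (d₀ : ℝ) : Prop :=
  (IsJointlyStrictlySubGaussian P ε ∧ HasCovarianceBound P ε d₀) ∨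
  (IsJointlyStrictlySubGaussian P ε ∧ ∃ f : ℝ → ℝ, IsStationaryWithSpectralDensity P ε f ∧
    BddAbove (range f) ∧ d₀ = 2 * Real.pi * ⨆ l, f l) ∨
  (∃ (ξ : ℝ → Ω → ℝ) (ψ : ℝ → ℝ) (h : ℝ → ℂ), IsMovingAverage P ε ξ ψ ∧
    IsTransferFunction ψ h ∧ BddAbove (range fun l => ‖h l‖ ^ 2) ∧
    d₀ = 2 * Real.pi * ⨆ l, ‖h l‖ ^ 2)

end Noise

/-! ### The regression model -/

section Model

variable {q : ℕ}

/-- The linear map of the diagonal matrix `diag(d_1, …, d_q)`. -/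
def diagMul (d : Fin q → ℝ) (x : EuclideanSpace ℝ (Fin q)) : EuclideanSpace ℝ (Fin q) :=
  WithLp.toLp 2 (fun i => d i * x i)

/-- Standing assumptions on the parameter set and on the regression function. -/
structure IsRegressionModel (Θ : Set (EuclideanSpace ℝ (Fin q)))
    (a : ℝ → EuclideanSpace ℝ (Fin q) → ℝ) : Prop where
  isOpen : IsOpen Θ
  isBounded : Bornology.IsBounded Θ
  convex : Convex ℝ Θ
  continuousOn : ContinuousOn (fun p : ℝ × EuclideanSpace ℝ (Fin q) => a p.1 p.2)
    (Ici 0 ×ˢ closure Θ)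
  contDiffOn : ∀ t, 0 ≤ t → ContDiffOn ℝ 1 (a t) Θ

/-- The contrast `Q_T(τ) = ∫₀ᵀ (x(t) - a(t, τ))² dt` for an observed path `x`. -/
def contrast (a : ℝ → EuclideanSpace ℝ (Fin q) → ℝ) (x : ℝ → ℝ) (T : ℝ)
    (τ : EuclideanSpace ℝ (Fin q)) : ℝ :=
  ∫ t in (0 : ℝ)..T, (x t - a t τ) ^ 2

/-- `θhat T`, `T > 0`, are least squares estimators: random vectors in the closure of `Θ` that
(almost surely) minimize the contrast of the path `X(t) = a(t, θ) + ε(t)`, `t ∈ [0, T]`, over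
the closure of `Θ`. -/
def IsLSE {Ω : Type*} [MeasurableSpace Ω] (P : Measure Ω)
    (Θ : Set (EuclideanSpace ℝ (Fin q))) (a : ℝ → EuclideanSpace ℝ (Fin q) → ℝ)
    (θ : EuclideanSpace ℝ (Fin q)) (ε : ℝ → Ω → ℝ)
    (θhat : ℝ → Ω → EuclideanSpace ℝ (Fin q)) : Prop :=
  ∀ T, 0 < T → Measurable (θhat T) ∧ ∀ᵐ ω ∂P, θhat T ω ∈ closure Θ ∧
    IsMinOn (contrast a (fun t => a t θ + ε t ω) T) (closure Θ) (θhat T ω)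

/-- `d_{iT}(τ) = (∫₀ᵀ (∂a(t, τ)/∂τ_i)² dt)^{1/2}`. -/
def derivNorm (a : ℝ → EuclideanSpace ℝ (Fin q) → ℝ) (T : ℝ)
    (τ : EuclideanSpace ℝ (Fin q)) (i : Fin q) : ℝ :=
  Real.sqrt (∫ t in (0 : ℝ)..T, (fderiv ℝ (a t) τ (EuclideanSpace.single i 1)) ^ 2)

/-- `s_T = diag(s_{1T}, …, s_{qT})` is a normalization: for constants `0 < c̲_i < c̄_i` and all
large `T`, `c̲_i < s_{iT}⁻¹ d_{iT}(τ) < c̄_i` uniformly in `τ ∈ Θ`. -/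
def IsNormalization (Θ : Set (EuclideanSpace ℝ (Fin q)))
    (a : ℝ → EuclideanSpace ℝ (Fin q) → ℝ) (s : ℝ → Fin q → ℝ) : Prop :=
  ∃ cl cu : Fin q → ℝ, (∀ i, 0 < cl i ∧ cl i < cu i) ∧
    ∃ T₀ : ℝ, ∀ T, T₀ < T → ∀ τ ∈ Θ, ∀ i,
      cl i < (s T i)⁻¹ * derivNorm a T τ i ∧ (s T i)⁻¹ * derivNorm a T τ i < cu i

/-- `U_T(θ) = s_T (Θᶜ - θ)`, where `Θᶜ` is the closure of `Θ`. -/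
def normedSet (Θ : Set (EuclideanSpace ℝ (Fin q))) (s : ℝ → Fin q → ℝ)
    (θ : EuclideanSpace ℝ (Fin q)) (T : ℝ) : Set (EuclideanSpace ℝ (Fin q)) :=
  (fun τ => diagMul (s T) (τ - θ)) '' closure Θ

/-- `Φ_T(u, v) = ∫₀ᵀ (a(t, θ + s_T⁻¹ u) - a(t, θ + s_T⁻¹ v))² dt`. -/
def Phi (a : ℝ → EuclideanSpace ℝ (Fin q) → ℝ) (s : ℝ → Fin q → ℝ)
    (θ : EuclideanSpace ℝ (Fin q)) (T : ℝ) (u v : EuclideanSpace ℝ (Fin q)) : ℝ :=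
  ∫ t in (0 : ℝ)..T, (a t (θ + diagMul (fun i => (s T i)⁻¹) u) -
    a t (θ + diagMul (fun i => (s T i)⁻¹) v)) ^ 2

/-- `0 < c₀ < c₁`, and for all large `T` and all `u, v ∈ U_T(θ)`,
`c₀ ‖u - v‖² ≤ Φ_T(u, v) ≤ c₁ ‖u - v‖²`. -/
def IsIdentifiable (Θ : Set (EuclideanSpace ℝ (Fin q)))
    (a : ℝ → EuclideanSpace ℝ (Fin q) → ℝ) (s : ℝ → Fin q → ℝ)
    (θ : EuclideanSpace ℝ (Fin q)) (c₀ c₁ : ℝ) : Prop :=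
  0 < c₀ ∧ c₀ < c₁ ∧ ∃ T₀ : ℝ, ∀ T, T₀ < T →
    ∀ u ∈ normedSet Θ s θ T, ∀ v ∈ normedSet Θ s θ T,
      c₀ * ‖u - v‖ ^ 2 ≤ Phi a s θ T u v ∧ Phi a s θ T u v ≤ c₁ * ‖u - v‖ ^ 2

end Model

end RegressionLSE

end

open RegressionLSE

/-! Let u = s_T(θ_T − θ) be the normalized error and Y(v) = ∫₀ᵀ ε(t)(a(t, θ + s_T⁻¹v) − a(t, θ)) dt.
Comparing the contrast at θ_T with that at θ gives Φ(u, 0) ≤ 2 Y(u). It therefore suffices to show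
that a point u with ‖u‖ ≥ H satisfying this inequality exists only with probability O(exp(−const ·
H²)), uniformly in T. The three claims are this bound at H = ρT^(1/2−ν), at H = h √(ln T), and,
since s_T ≥ c√T, at H = c√T r.

The noise enters only through one fact, `NoiseCondition.hasSubgaussianMGF_integral`: ∫₀ᵀ εΔ is
sub-Gaussian with variance proxy d₀ ∫₀ᵀ Δ². Riemann sums are linear combinations of values of ε,
hence strictly sub-Gaussian; they converge almost surely to the integral and their variances
converge to the covariance form, so Fatou's lemma carries the exponential bound over. The covariance
form is at most d₀ ∫ Δ² by assumption in the first case, and by Plancherel in the other two, where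
the covariance has spectral density f or |h|².

Thus Y(u) − Y(v) has variance proxy d Φ(u, v) ≤ d c₁ ‖u − v‖². `exists_contrast_tail` cuts the
normalized parameter set into unit lattice cells and picks in each relevant cell a point v with ‖v‖
≥ H. With N = Φ(v, 0), the event forces either Y(v) to be nearly N/2 or Y to oscillate by N/25
within the cell. The first costs about exp(−N/(8d)) with N ≥ c₀ ‖v‖², the second exp(−const · N²) by
the chaining bound `exists_chaining_tail`. The rate is lowered from c₀/(8d) to c₀/(16d), which pays
for the approximations and leaves a Gaussian factor summable over the cells. For q ≥ 1 this is at
least c₀/(8d₀(1+q)) when d = d₀ > 0; the case q = 0 is degenerate and d₀ = 0 allows any d > 0. The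
resulting rate has no β loss. -/

open scoped FourierTransform ENNReal

noncomputable section

namespace RegressionLSE

/-! ### Plancherel identities and quadratic forms with a spectral density -/

/-- On `L¹ ∩ L²` the `L²` Fourier transform is the Fourier integral. -/
theorem fourier_toLp_ae_eq {f : ℝ → ℂ} (h1 : Integrable f) (h2 : MemLp f 2) :
    (𝓕 (h2.toLp f) : Lp ℂ 2 (volume : Measure ℝ)) =ᵐ[volume] 𝓕 f := by
  have hL : LocallyIntegrable (𝓕 (h2.toLp f) : Lp ℂ 2 (volume : Measure ℝ)) volume :=
    (Lp.memLp (𝓕 (h2.toLp f) : Lp ℂ 2 (volume : Measure ℝ))).locallyIntegrable one_le_two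
  have hc : Continuous (𝓕 f : ℝ → ℂ) :=
    VectorFourier.fourierIntegral_continuous (L := innerₗ ℝ) Real.continuous_fourierChar
      (by exact continuous_inner) h1
  have hL' : LocallyIntegrable (𝓕 f : ℝ → ℂ) volume := hc.locallyIntegrable
  -- Both transforms are locally integrable, so testing against smooth compactly supported functions
  -- suffices; on these, each pairing moves the transform onto the test function, by duality for
  -- tempered distributions on one side and by Fubini on the other.
  refine ae_eq_of_integral_contDiff_smul_eq hL hL' ?_
  · intro g hg hgc
    have hc1 : HasCompactSupport (fun x => (g x : ℂ)) := 
      hgc.comp_left (g := fun x : ℝ => (x : ℂ)) Complex.ofReal_zero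
    have hc2 : ContDiff ℝ (⊤ : ℕ∞) (fun x => (g x : ℂ)) := Complex.ofRealCLM.contDiff.comp hg
    set G := hc1.toSchwartzMap hc2 with hG
    have e1 := congrArg (fun D : TemperedDistribution ℝ ℂ => D G)
      (Lp.fourier_toTemperedDistribution_eq (h2.toLp f))
    simp only [TemperedDistribution.fourier_apply, Lp.toTemperedDistribution_apply] at e1
    have e2 : ∫ x, g x • (𝓕 (h2.toLp f) : Lp ℂ 2 (volume : Measure ℝ)) x =
        ∫ x, G x • (𝓕 (h2.toLp f) : Lp ℂ 2 (volume : Measure ℝ)) x := by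
      congr 1
    rw [e2, ← e1]
    have e3 : ∫ x, (𝓕 G) x • (h2.toLp f) x = ∫ x, (𝓕 (G : ℝ → ℂ)) x • f x := by
      refine integral_congr_ae ?_
      filter_upwards [h2.coeFn_toLp] with x hx
      rw [hx]; rfl
    rw [e3]
    have := VectorFourier.integral_fourierIntegral_smul_eq_flip (𝕜 := ℝ) (μ := volume) (ν := volume)
      (L := innerₗ ℝ) (f := G) (g := f) Real.continuous_fourierChar (by fun_prop) G.integrable h1
    simp only [flip_innerₗ] at this
    exact this

theorem memLp_fourier {f : ℝ → ℂ} (h1 : Integrable f) (h2 : MemLp f 2) : MemLp (𝓕 f) 2 :=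
  (Lp.memLp (𝓕 (h2.toLp f))).ae_eq (fourier_toLp_ae_eq h1 h2)

open ComplexConjugate in
theorem integral_conj_fourier_mul {f g : ℝ → ℂ} (hf1 : Integrable f) (hf2 : MemLp f 2)
    (hg1 : Integrable g) (hg2 : MemLp g 2) :
    ∫ x, conj (𝓕 f x) * 𝓕 g x = ∫ x, conj (f x) * g x := by
  have h := Lp.inner_fourier_eq (hf2.toLp f) (hg2.toLp g)
  rw [L2.inner_def, L2.inner_def] at h
  have e1 : ∫ x, conj (𝓕 f x) * 𝓕 g x = ∫ x, inner ℂ ((𝓕 (hf2.toLp f) : Lp ℂ 2 (volume : Measure ℝ)) x)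
      ((𝓕 (hg2.toLp g) : Lp ℂ 2 (volume : Measure ℝ)) x) := by
    refine integral_congr_ae ?_
    filter_upwards [fourier_toLp_ae_eq hf1 hf2, fourier_toLp_ae_eq hg1 hg2] with x hx hy
    rw [hx, hy, RCLike.inner_apply, mul_comm]
  have e2 : ∫ x, conj (f x) * g x = ∫ x, inner ℂ (hf2.toLp f x) (hg2.toLp g x) := by
    refine integral_congr_ae ?_
    filter_upwards [hf2.coeFn_toLp, hg2.coeFn_toLp] with x hx hy
    rw [hx, hy, RCLike.inner_apply, mul_comm]
  rw [e1, e2, h]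

theorem integral_norm_fourier_sq {f : ℝ → ℂ} (hf1 : Integrable f) (hf2 : MemLp f 2) :
    ∫ x, ‖𝓕 f x‖ ^ 2 = ∫ x, ‖f x‖ ^ 2 := by
  have h := integral_conj_fourier_mul hf1 hf2 hf1 hf2
  simp only [RCLike.conj_mul] at h
  have key : ∀ F : ℝ → ℂ, ∫ x, ((RCLike.ofReal ‖F x‖ : ℂ)) ^ 2 = ((∫ x, ‖F x‖ ^ 2 : ℝ) : ℂ) := by
    intro F
    rw [← integral_complex_ofReal]
    simp
  rw [key, key] at h
  exact_mod_cast h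

/-- Conversion between Mathlib's kernel `e^{-2πixt}` and the angular frequency used by the spectral
density; the rescaling by `2π` is the source of the factor `2π` in `d₀`. -/
theorem fourier_div_two_pi (g : ℝ → ℂ) (l : ℝ) :
    𝓕 g (l / (2 * Real.pi)) = ∫ t : ℝ, g t * Complex.exp (-(Complex.I * (l : ℂ) * (t : ℂ))) := by
  rw [Real.fourier_real_eq_integral_exp_smul]
  refine integral_congr_ae (Eventually.of_forall fun t => ?_)
  simp only [smul_eq_mul]
  rw [mul_comm]
  congr 2
  push_cast
  have : (Real.pi : ℂ) ≠ 0 := by exact_mod_cast Real.pi_ne_zero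
  field_simp

/-- Inserting the spectral representation and applying Fubini, the double integral in `(t, s)`
factors at each frequency as a transform times its conjugate. Absolute integrability is immediate
because the exponential is unimodular and `f`, `g` are in `L¹`. -/
theorem spectral_quadratic_form_eq {f : ℝ → ℝ} (hf : Integrable f)
    {K : ℝ → ℝ → ℝ} {g : ℝ → ℝ} (hg : Integrable g)
    (hK : ∀ t s, ((K t s : ℝ) : ℂ) =
      ∫ l : ℝ, Complex.exp (Complex.I * (l : ℂ) * ((s - t : ℝ) : ℂ)) * (f l : ℂ)) :
    ∫ t, ∫ s, K t s * g t * g s =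
      ∫ l, f l * ‖𝓕 (fun t => (g t : ℂ)) (l / (2 * Real.pi))‖ ^ 2 := by
  have hgc : Integrable (fun t => (g t : ℂ)) := hg.ofReal
  have hfc : Integrable (fun t => (f t : ℂ)) := hf.ofReal
  set F : (ℝ × ℝ) → ℝ → ℂ := fun p l =>
    Complex.exp (Complex.I * (l : ℂ) * ((p.2 - p.1 : ℝ) : ℂ)) * (((g p.1 : ℂ) * (g p.2 : ℂ)) * (f l : ℂ))
    with hFdef
  have hF : Integrable (Function.uncurry F) ((volume.prod volume).prod volume) := by
    have h0 := (hgc.mul_prod hgc).mul_prod hfc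
    refine h0.mono ?_ ?_
    · refine AEStronglyMeasurable.mul (Continuous.aestronglyMeasurable ?_) h0.1
      fun_prop
    · refine Eventually.of_forall fun z => ?_
      simp only [hFdef, Function.uncurry, norm_mul]
      have : ‖Complex.exp (Complex.I * (z.2 : ℂ) * ((z.1.2 - z.1.1 : ℝ) : ℂ))‖ = 1 := by
        rw [Complex.norm_exp]; simp
      rw [this, one_mul]
  have hswap := integral_integral_swap hF
  have hL : ∀ p : ℝ × ℝ, ∫ l, F p l = ((K p.1 p.2 * g p.1 * g p.2 : ℝ) : ℂ) := by
    intro p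
    push_cast
    rw [hK, mul_assoc, ← integral_mul_const]
    refine integral_congr_ae (Eventually.of_forall fun l => ?_)
    simp only [hFdef]; ring
  have hR : ∀ l : ℝ, ∫ p, F p l ∂(volume.prod volume) =
      ((f l * ‖𝓕 (fun t => (g t : ℂ)) (l / (2 * Real.pi))‖ ^ 2 : ℝ) : ℂ) := by
    intro l
    have e1 : ∀ p, F p l = (f l : ℂ) *
        (((g p.1 : ℂ) * Complex.exp (-(Complex.I * (l : ℂ) * (p.1 : ℂ)))) *
        ((g p.2 : ℂ) * Complex.exp (Complex.I * (l : ℂ) * (p.2 : ℂ)))) := by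
      intro p
      have : Complex.exp (Complex.I * (l : ℂ) * ((p.2 - p.1 : ℝ) : ℂ)) =
          Complex.exp (-(Complex.I * (l : ℂ) * (p.1 : ℂ))) *
          Complex.exp (Complex.I * (l : ℂ) * (p.2 : ℂ)) := by
        rw [← Complex.exp_add]; congr 1; push_cast; ring
      simp only [hFdef, this]; ring
    simp_rw [e1]
    rw [integral_const_mul, integral_prod_mul
      (fun t : ℝ => (g t : ℂ) * Complex.exp (-(Complex.I * (l : ℂ) * (t : ℂ))))
      (fun t : ℝ => (g t : ℂ) * Complex.exp (Complex.I * (l : ℂ) * (t : ℂ))),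
      ← fourier_div_two_pi]
    have e2 : ∫ t : ℝ, (g t : ℂ) * Complex.exp (Complex.I * (l : ℂ) * (t : ℂ)) =
        (starRingEnd ℂ) (𝓕 (fun t => (g t : ℂ)) (l / (2 * Real.pi))) := by
      rw [fourier_div_two_pi, ← integral_conj]
      refine integral_congr_ae (Eventually.of_forall fun t => ?_)
      simp [← Complex.exp_conj]
    rw [e2, Complex.mul_conj, Complex.normSq_eq_norm_sq]
    push_cast; ring
  simp_rw [hL, hR] at hswap
  rw [integral_complex_ofReal, integral_complex_ofReal] at hswap
  have hint : Integrable (fun p : ℝ × ℝ => K p.1 p.2 * g p.1 * g p.2) (volume.prod volume) := by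
    have := hF.integral_prod_left
    simp only [Function.uncurry] at this
    simp_rw [hL] at this
    exact this.re
  rw [integral_prod _ hint] at hswap
  exact_mod_cast hswap

/-- A covariance kernel with spectral density at most `M` has operator norm at most `2πM`. -/
theorem spectral_quadratic_form_le {f : ℝ → ℝ} (hf : Integrable f) {M : ℝ} (h0 : ∀ l, 0 ≤ f l)
    (hM : ∀ l, f l ≤ M) {K : ℝ → ℝ → ℝ} {g : ℝ → ℝ} (hg : Integrable g) (hg2 : MemLp g 2)
    (hK : ∀ t s, ((K t s : ℝ) : ℂ) =
      ∫ l : ℝ, Complex.exp (Complex.I * (l : ℂ) * ((s - t : ℝ) : ℂ)) * (f l : ℂ)) :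
    ∫ t, ∫ s, K t s * g t * g s ≤ 2 * Real.pi * M * ∫ t, g t ^ 2 := by
  rw [spectral_quadratic_form_eq hf hg hK]
  have hgc : Integrable (fun t => (g t : ℂ)) := hg.ofReal
  have hgc2 : MemLp (fun t => (g t : ℂ)) 2 := hg2.ofReal
  have hi : Integrable (fun l => ‖𝓕 (fun t => (g t : ℂ)) (l / (2 * Real.pi))‖ ^ 2) :=
    ((memLp_fourier hgc hgc2).integrable_norm_pow (by norm_num)).comp_div (by positivity)
  calc ∫ l, f l * ‖𝓕 (fun t => (g t : ℂ)) (l / (2 * Real.pi))‖ ^ 2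
      ≤ ∫ l, M * ‖𝓕 (fun t => (g t : ℂ)) (l / (2 * Real.pi))‖ ^ 2 := by
        refine integral_mono_of_nonneg ?_ (hi.const_mul M) ?_
        · exact Eventually.of_forall fun l => mul_nonneg (h0 l) (by positivity)
        · exact Eventually.of_forall fun l => mul_le_mul_of_nonneg_right (hM l) (by positivity)
    _ = 2 * Real.pi * M * ∫ t, g t ^ 2 := by
        rw [integral_const_mul,
          Measure.integral_comp_div (fun l => ‖𝓕 (fun t => (g t : ℂ)) l‖ ^ 2),
          integral_norm_fourier_sq hgc hgc2, abs_of_pos (by positivity)]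
        simp only [Complex.norm_real, Real.norm_eq_abs, sq_abs, smul_eq_mul]
        ring

/-! ### `L²` limits and strictly sub-Gaussian variables -/

theorem tendsto_integral_inner {α : Type*} [MeasurableSpace α] {μ : Measure α} {𝕜 : Type*} [RCLike 𝕜]
    {f g : α → 𝕜} {fs gs : ℕ → α → 𝕜} (hf : MemLp f 2 μ) (hg : MemLp g 2 μ)
    (hfs : ∀ m, MemLp (fs m) 2 μ) (hgs : ∀ m, MemLp (gs m) 2 μ)
    (hfl : Tendsto (fun m => eLpNorm (f - fs m) 2 μ) atTop (𝓝 0))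
    (hgl : Tendsto (fun m => eLpNorm (g - gs m) 2 μ) atTop (𝓝 0)) :
    Tendsto (fun m => ∫ x, inner 𝕜 (fs m x) (gs m x) ∂μ) atTop (𝓝 (∫ x, inner 𝕜 (f x) (g x) ∂μ)) := by
  have key : ∀ {u v : α → 𝕜} (hu : MemLp u 2 μ) (hv : MemLp v 2 μ),
      ∫ x, inner 𝕜 (u x) (v x) ∂μ = inner 𝕜 (hu.toLp u) (hv.toLp v) := by
    intro u v hu hv
    rw [L2.inner_def]
    refine integral_congr_ae ?_
    filter_upwards [hu.coeFn_toLp, hv.coeFn_toLp] with x hx hy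
    rw [hx, hy]
  have hlim : ∀ {u : α → 𝕜} {us : ℕ → α → 𝕜} (hu : MemLp u 2 μ) (hus : ∀ m, MemLp (us m) 2 μ),
      Tendsto (fun m => eLpNorm (u - us m) 2 μ) atTop (𝓝 0) →
      Tendsto (fun m => (hus m).toLp (us m)) atTop (𝓝 (hu.toLp u)) := by
    intro u us hu hus h
    rw [Lp.tendsto_Lp_iff_tendsto_eLpNorm'' us hus u hu]
    refine h.congr fun m => ?_
    rw [eLpNorm_sub_comm]
  rw [key hf hg]
  simp_rw [fun m => key (hfs m) (hgs m)]
  exact (hlim hf hfs hfl).inner (hlim hg hgs hgl)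

section
variable {Ω : Type*} [MeasurableSpace Ω]

/-- `E exp X ≤ exp (E X² / 2)` for a square integrable random variable `X`. -/
structure IsStrictlySubGaussianRV (P : Measure Ω) (X : Ω → ℝ) : Prop where
  memLp : MemLp X 2 P
  integrable_exp : Integrable (fun ω => Real.exp (X ω)) P
  integral_exp_le : ∫ ω, Real.exp (X ω) ∂P ≤ Real.exp ((∫ ω, X ω ^ 2 ∂P) / 2)

/-- Fatou's lemma for the exponentials; it also yields integrability of the limit, so no uniform
integrability is needed. -/
theorem integral_exp_le_of_tendsto_ae {P : Measure Ω} {X : Ω → ℝ} {Xs : ℕ → Ω → ℝ} {v : ℝ}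
    {vs : ℕ → ℝ} (hX : AEStronglyMeasurable X P)
    (hi : ∀ m, Integrable (fun ω => Real.exp (Xs m ω)) P)
    (hle : ∀ m, ∫ ω, Real.exp (Xs m ω) ∂P ≤ Real.exp (vs m))
    (hlim : ∀ᵐ ω ∂P, Tendsto (fun m => Xs m ω) atTop (𝓝 (X ω)))
    (hv : Tendsto vs atTop (𝓝 v)) :
    Integrable (fun ω => Real.exp (X ω)) P ∧ ∫ ω, Real.exp (X ω) ∂P ≤ Real.exp v := by
  have hle' : ∫⁻ ω, ENNReal.ofReal (Real.exp (X ω)) ∂P ≤ ENNReal.ofReal (Real.exp v) := by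
    calc ∫⁻ ω, ENNReal.ofReal (Real.exp (X ω)) ∂P
        = ∫⁻ ω, liminf (fun m => ENNReal.ofReal (Real.exp (Xs m ω))) atTop ∂P := by
          refine lintegral_congr_ae ?_
          filter_upwards [hlim] with ω hω
          refine (Tendsto.liminf_eq ?_).symm
          exact ENNReal.tendsto_ofReal ((Real.continuous_exp.tendsto _).comp hω)
      _ ≤ liminf (fun m => ∫⁻ ω, ENNReal.ofReal (Real.exp (Xs m ω)) ∂P) atTop :=
          lintegral_liminf_le' fun m => (hi m).1.aemeasurable.ennreal_ofReal
      _ ≤ liminf (fun m => ENNReal.ofReal (Real.exp (vs m))) atTop := by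
          refine liminf_le_liminf (Eventually.of_forall fun m => ?_)
          rw [← ofReal_integral_eq_lintegral_ofReal (hi m)
            (Eventually.of_forall fun ω => (Real.exp_pos _).le)]
          exact ENNReal.ofReal_le_ofReal (hle m)
      _ = ENNReal.ofReal (Real.exp v) :=
          (ENNReal.tendsto_ofReal ((Real.continuous_exp.tendsto _).comp hv)).liminf_eq
  have hm : AEStronglyMeasurable (fun ω => Real.exp (X ω)) P :=
    Real.continuous_exp.comp_aestronglyMeasurable hX
  have hint : Integrable (fun ω => Real.exp (X ω)) P := by
    refine ⟨hm, ?_⟩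
    rw [hasFiniteIntegral_iff_ofReal (Eventually.of_forall fun ω => (Real.exp_pos _).le)]
    exact hle'.trans_lt ENNReal.ofReal_lt_top
  refine ⟨hint, ?_⟩
  rw [integral_eq_lintegral_of_nonneg_ae (Eventually.of_forall fun ω => (Real.exp_pos _).le) hm]
  exact ENNReal.toReal_le_of_le_ofReal (Real.exp_pos _).le hle'

/-- In `L²` the second moments converge and a subsequence converges almost surely, which is all the
Fatou argument requires. This transfers strict sub-Gaussianity from the driver of a moving average
to the moving average. -/
theorem IsStrictlySubGaussianRV.of_tendsto {P : Measure Ω} {X : Ω → ℝ} {Xs : ℕ → Ω → ℝ}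
    (hX : MemLp X 2 P) (hXs : ∀ m, IsStrictlySubGaussianRV P (Xs m))
    (hlim : Tendsto (fun m => eLpNorm (X - Xs m) 2 P) atTop (𝓝 0)) :
    IsStrictlySubGaussianRV P X := by
  have h2 : Tendsto (fun m => ∫ ω, Xs m ω ^ 2 ∂P) atTop (𝓝 (∫ ω, X ω ^ 2 ∂P)) := by
    have := tendsto_integral_inner hX hX (fun m => (hXs m).memLp) (fun m => (hXs m).memLp) hlim hlim
    simpa [← pow_two] using this
  have hmeas : TendstoInMeasure P Xs atTop X := by
    refine tendstoInMeasure_of_tendsto_eLpNorm two_ne_zero (fun m => (hXs m).memLp.1) hX.1 ?_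
    refine hlim.congr fun m => ?_
    rw [eLpNorm_sub_comm]
  obtain ⟨ns, hns, hae⟩ := hmeas.exists_seq_tendsto_ae
  have := integral_exp_le_of_tendsto_ae (v := (∫ ω, X ω ^ 2 ∂P) / 2)
    (vs := fun i => (∫ ω, Xs (ns i) ω ^ 2 ∂P) / 2) hX.1
    (fun i => (hXs (ns i)).integrable_exp) (fun i => (hXs (ns i)).integral_exp_le) hae
    ((h2.comp hns.tendsto_atTop).div_const 2)
  exact ⟨hX, this.1, this.2⟩

theorem IsJointlyStrictlySubGaussian.of_mem_span {P : Measure Ω} {ξ : ℝ → Ω → ℝ}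
    (hξ : IsJointlyStrictlySubGaussian P ξ) (hm : ∀ t, MemLp (ξ t) 2 P) {X : Ω → ℝ}
    (hX : X ∈ Submodule.span ℝ (range ξ)) : IsStrictlySubGaussianRV P X := by
  obtain ⟨c, rfl⟩ := Finsupp.mem_span_range_iff_exists_finsupp.1 hX
  set n := c.support.card
  set e : Fin n ≃ c.support := c.support.equivFin.symm
  have hsum : (c.sum fun i a => a • ξ i) = fun ω => ∑ j : Fin n, ξ (e j) ω * c (e j) := by
    ext ω
    rw [Finsupp.sum, Finset.sum_apply, ← Finset.sum_coe_sort]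
    rw [← e.sum_comp]
    refine Finset.sum_congr rfl fun j _ => ?_
    simp [mul_comm]
  rw [hsum]
  obtain ⟨h1, h2⟩ := hξ n (fun j => e j) (fun j => c (e j))
  refine ⟨?_, h1, h2.trans (le_of_eq ?_)⟩
  · exact memLp_finsetSum _ fun j _ => (hm (e j)).mul_const _
  · congr 1
    have : ∀ ω, (∑ j : Fin n, ξ (e j) ω * c (e j)) ^ 2 =
        ∑ i : Fin n, ∑ j : Fin n, (ξ (e i) ω * ξ (e j) ω) * (c (e i) * c (e j)) := by
      intro ω
      rw [pow_two, Finset.sum_mul_sum]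
      refine Finset.sum_congr rfl fun i _ => Finset.sum_congr rfl fun j _ => ?_
      ring
    simp_rw [this]
    have hij : ∀ i j : Fin n, Integrable (fun ω => (ξ (e i) ω * ξ (e j) ω) * (c (e i) * c (e j))) P :=
      fun i j => ((hm (e i)).integrable_mul (hm (e j))).mul_const _
    rw [integral_finsetSum _ fun i _ => integrable_finsetSum _ fun j _ => hij i j]
    simp_rw [fun i => integral_finsetSum Finset.univ fun j _ => hij i j, integral_mul_const]
    rw [one_div, inv_mul_eq_div]
    congr 1
    refine Finset.sum_congr rfl fun i _ => Finset.sum_congr rfl fun j _ => ?_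
    ring
end

/-! ### Isometry of the mean-square integral -/

/-- The overlap of two intervals is put in the shape that polarization produces for products of
increments, so that the isometry on step functions becomes a termwise match. -/
theorem integral_indicator_Ico_mul {α β γ δ : ℝ} (h1 : α ≤ β) (h2 : γ ≤ δ) :
    ∫ s, (Ico α β).indicator (fun _ => (1 : ℝ)) s * (Ico γ δ).indicator (fun _ => (1 : ℝ)) s =
      (|β - γ| + |α - δ| - |β - δ| - |α - γ|) / 2 := by
  have e : ∀ s, (Ico α β).indicator (fun _ => (1 : ℝ)) s * (Ico γ δ).indicator (fun _ => (1 : ℝ)) s =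
      (Ico (max α γ) (min β δ)).indicator (fun _ => (1 : ℝ)) s := by
    intro s
    rw [← Ico_inter_Ico]
    by_cases h3 : s ∈ Ico α β <;> by_cases h4 : s ∈ Ico γ δ <;> simp [indicator, h3, h4]
  simp_rw [e]
  rw [integral_indicator measurableSet_Ico, setIntegral_const, measureReal_def, Real.volume_Ico]
  rw [ENNReal.toReal_ofReal']
  simp only [smul_eq_mul, mul_one]
  rcases abs_cases (β - γ) with h3 | h3 <;> rcases abs_cases (α - δ) with h4 | h4 <;>
  rcases abs_cases (β - δ) with h5 | h5 <;> rcases abs_cases (α - γ) with h6 | h6 <;>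
  rcases max_cases α γ with h7 | h7 <;> rcases min_cases β δ with h8 | h8 <;>
  rcases max_cases (min β δ - max α γ) 0 with h9 | h9 <;> linarith

theorem StepData.integral_mem_span {Ω : Type*} (ξ : ℝ → Ω → ℝ) (σ : StepData) :
    σ.integral ξ ∈ Submodule.span ℝ (range ξ) := by
  have : σ.integral ξ = ∑ l, σ.coeff l • (ξ (σ.right l) - ξ (σ.left l)) := by
    ext ω; simp [StepData.integral]
  rw [this]
  exact Submodule.sum_mem _ fun l _ => Submodule.smul_mem _ _ (Submodule.sub_mem _
    (Submodule.subset_span (mem_range_self _)) (Submodule.subset_span (mem_range_self _)))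

section
variable {Ω : Type*} [MeasurableSpace Ω] {P : Measure Ω} {ξ : ℝ → Ω → ℝ}

theorem IsSubGaussianOrthogonalIncrement.integral_sub_sq
    (hξ : IsSubGaussianOrthogonalIncrement P ξ) (t s : ℝ) :
    ∫ ω, (ξ t ω - ξ s ω) ^ 2 ∂P = |t - s| := by
  rcases lt_trichotomy s t with h | rfl | h
  · have := hξ.increment_variance s (t - s) (sub_pos.2 h)
    rw [add_sub_cancel] at this
    rw [this, abs_of_pos (sub_pos.2 h)]
  · simp
  · have := hξ.increment_variance t (s - t) (sub_pos.2 h)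
    rw [add_sub_cancel] at this
    rw [abs_of_neg (sub_neg.2 h), neg_sub, ← this]
    congr 1; ext ω; ring

/-- Polarization: the product of two increments is a signed combination of four squared increments,
whose means are the distances `|t - s|`. -/
theorem IsSubGaussianOrthogonalIncrement.integral_mul_increments
    (hξ : IsSubGaussianOrthogonalIncrement P ξ) (α β γ δ : ℝ) :
    ∫ ω, (ξ β ω - ξ α ω) * (ξ δ ω - ξ γ ω) ∂P =
      (|β - γ| + |α - δ| - |β - δ| - |α - γ|) / 2 := by
  have hi : ∀ t s, Integrable (fun ω => (ξ t ω - ξ s ω) ^ 2) P := fun t s =>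
    ((hξ.mean_square_continuous.1 t).sub (hξ.mean_square_continuous.1 s)).integrable_sq
  have : ∀ ω, (ξ β ω - ξ α ω) * (ξ δ ω - ξ γ ω) = ((ξ β ω - ξ γ ω) ^ 2 + (ξ α ω - ξ δ ω) ^ 2 -
    (ξ β ω - ξ δ ω) ^ 2 - (ξ α ω - ξ γ ω) ^ 2) / 2 := fun ω => by ring
  simp_rw [this]
  rw [integral_div, integral_sub, integral_sub, integral_add (hi _ _) (hi _ _)]
  · simp_rw [hξ.integral_sub_sq]
  · exact (hi _ _).add (hi _ _)
  · exact hi _ _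
  · exact ((hi _ _).add (hi _ _)).sub (hi _ _)
  · exact hi _ _

theorem StepData.memLp_toFun (σ : StepData) : MemLp σ.toFun 2 := by
  unfold StepData.toFun
  refine memLp_finsetSum _ fun l _ => MemLp.const_mul ?_ _
  exact memLp_indicator_const 2 measurableSet_Ico 1 (Or.inr (by simp))

theorem IsSubGaussianOrthogonalIncrement.integral_step_mul
    (hξ : IsSubGaussianOrthogonalIncrement P ξ) (σ τ : StepData) :
    ∫ ω, σ.integral ξ ω * τ.integral ξ ω ∂P = ∫ s, σ.toFun s * τ.toFun s := by
  have hm : ∀ t s, MemLp (fun ω => ξ t ω - ξ s ω) 2 P := fun t s =>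
    (hξ.mean_square_continuous.1 t).sub (hξ.mean_square_continuous.1 s)
  have hI : ∀ α β : ℝ, MemLp ((Ico α β).indicator (fun _ => (1 : ℝ))) 2 := fun α β =>
    memLp_indicator_const 2 measurableSet_Ico 1 (Or.inr (by simp))
  simp only [StepData.integral, StepData.toFun, Finset.sum_mul_sum]
  have h1 : ∀ l k, Integrable (fun ω => (σ.coeff l * (ξ (σ.right l) ω - ξ (σ.left l) ω)) *
      (τ.coeff k * (ξ (τ.right k) ω - ξ (τ.left k) ω))) P := fun l k =>
    ((hm _ _).const_mul _).integrable_mul ((hm _ _).const_mul _)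
  have h2 : ∀ l k, Integrable (fun s =>
      (σ.coeff l * (Ico (σ.left l) (σ.right l)).indicator (fun _ => (1 : ℝ)) s) *
      (τ.coeff k * (Ico (τ.left k) (τ.right k)).indicator (fun _ => (1 : ℝ)) s)) := fun l k =>
    ((hI _ _).const_mul _).integrable_mul ((hI _ _).const_mul _)
  rw [integral_finsetSum _ fun i _ => integrable_finsetSum _ fun j _ => h1 i j,
    integral_finsetSum _ fun i _ => integrable_finsetSum _ fun j _ => h2 i j]
  refine Finset.sum_congr rfl fun l _ => ?_
  rw [integral_finsetSum _ fun j _ => h1 l j, integral_finsetSum _ fun j _ => h2 l j]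
  refine Finset.sum_congr rfl fun k _ => ?_
  simp_rw [mul_mul_mul_comm]
  rw [integral_const_mul, integral_const_mul, hξ.integral_mul_increments,
    integral_indicator_Ico_mul (σ.left_le_right l) (τ.left_le_right k)]

/-- Isometry of the mean-square integral, read on the covariance of a moving average. -/
theorem IsMovingAverage.covFun_eq {ε : ℝ → Ω → ℝ} {ψ : ℝ → ℝ} (h : IsMovingAverage P ε ξ ψ)
    (hε : ∀ t, MemLp (ε t) 2 P) (t s : ℝ) :
    covFun P ε t s = ∫ u, ψ (t - u) * ψ (s - u) := by
  obtain ⟨σ, hσ1, hσ2⟩ := h.representation t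
  obtain ⟨τ, hτ1, hτ2⟩ := h.representation s
  have hψ : ∀ t, MemLp (fun u => ψ (t - u)) 2 := fun t =>
    h.kernel_memLp.comp_measurePreserving (Measure.measurePreserving_sub_left volume t)
  have hI : ∀ ρ : StepData, MemLp (ρ.integral ξ) 2 P := fun ρ =>
    (h.driver.jointly_ssg.of_mem_span h.driver.mean_square_continuous.1 (ρ.integral_mem_span ξ)).memLp
  have l1 := tendsto_integral_inner (hε t) (hε s) (fun m => hI (σ m)) (fun m => hI (τ m)) hσ2 hτ2
  have l2 := tendsto_integral_inner (hψ t) (hψ s) (fun m => (σ m).memLp_toFun)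
    (fun m => (τ m).memLp_toFun) hσ1 hτ1
  simp only [RCLike.inner_apply, conj_trivial] at l1 l2
  simp_rw [fun m => h.driver.integral_step_mul (τ m) (σ m)] at l1
  have := tendsto_nhds_unique l1 l2
  simpa only [covFun, mul_comm] using this

/-- Being an `L²` limit of combinations of driver values is stable under linear operations, so the
whole span of `ε` inherits strict sub-Gaussianity from the driver. -/
theorem IsMovingAverage.of_mem_span {ε : ℝ → Ω → ℝ} {ψ : ℝ → ℝ} (h : IsMovingAverage P ε ξ ψ)
    (hε : ∀ t, MemLp (ε t) 2 P) {X : Ω → ℝ} (hX : X ∈ Submodule.span ℝ (range ε)) :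
    IsStrictlySubGaussianRV P X := by
  have hsg : ∀ Y ∈ Submodule.span ℝ (range ξ), IsStrictlySubGaussianRV P Y := fun Y hY =>
    h.driver.jointly_ssg.of_mem_span h.driver.mean_square_continuous.1 hY
  have key : MemLp X 2 P ∧ ∃ Xs : ℕ → Ω → ℝ, (∀ m, Xs m ∈ Submodule.span ℝ (range ξ)) ∧
      Tendsto (fun m => eLpNorm (X - Xs m) 2 P) atTop (𝓝 0) := by
    induction hX using Submodule.span_induction with
    | mem X hX =>
      obtain ⟨t, rfl⟩ := hX
      obtain ⟨σ, -, hσ⟩ := h.representation t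
      exact ⟨hε t, fun m => (σ m).integral ξ, fun m => (σ m).integral_mem_span ξ, hσ⟩
    | zero => exact ⟨MemLp.zero, fun _ => 0, fun _ => Submodule.zero_mem _, by simp⟩
    | add X Y _ _ hX hY =>
      obtain ⟨hX, Xs, hXs, hXl⟩ := hX
      obtain ⟨hY, Ys, hYs, hYl⟩ := hY
      refine ⟨hX.add hY, fun m => Xs m + Ys m, fun m => Submodule.add_mem _ (hXs m) (hYs m), ?_⟩
      have hlim := hXl.add hYl
      rw [add_zero] at hlim
      refine tendsto_of_tendsto_of_tendsto_of_le_of_le tendsto_const_nhds hlim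
        (fun _ => zero_le) fun m => ?_
      rw [add_sub_add_comm]
      exact eLpNorm_add_le (hX.sub (hsg _ (hXs m)).memLp).1 (hY.sub (hsg _ (hYs m)).memLp).1
        one_le_two
    | smul c X _ hX =>
      obtain ⟨hX, Xs, hXs, hXl⟩ := hX
      refine ⟨hX.const_smul c, fun m => c • Xs m, fun m => Submodule.smul_mem _ _ (hXs m), ?_⟩
      simp_rw [← smul_sub, eLpNorm_const_smul]
      have := ENNReal.Tendsto.const_mul hXl (Or.inr (enorm_ne_top (x := c)))
      simpa using this
  obtain ⟨hX2, Xs, hXs, hlim⟩ := key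
  exact IsStrictlySubGaussianRV.of_tendsto hX2 (fun m => hsg _ (hXs m)) hlim
end

/-! ### Spectral density of a moving average -/

open ComplexConjugate in
theorem fourier_reflect_translate (g : ℝ → ℝ) (t x : ℝ) :
    𝓕 (fun u => ((g (t - u) : ℝ) : ℂ)) x =
      Complex.exp (-(Complex.I * ((2 * Real.pi * x : ℝ) : ℂ) * (t : ℂ))) * conj (𝓕 (fun u => (g u : ℂ)) x) := by
  have hx : x = (2 * Real.pi * x) / (2 * Real.pi) := by
    field_simp
  rw [hx, fourier_div_two_pi, fourier_div_two_pi, ← hx, ← integral_conj, ← integral_const_mul,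
    ← integral_sub_left_eq_self _ volume t]
  refine integral_congr_ae (Eventually.of_forall fun u => ?_)
  simp only [sub_sub_cancel, map_mul, Complex.conj_ofReal, ← Complex.exp_conj, map_neg,
    Complex.conj_I]
  rw [mul_left_comm, ← Complex.exp_add]
  congr 2
  push_cast; ring

/-- Parseval applied to the two reflected translates of `g`, whose transforms differ only by a
phase. The right side is kept as an inner product so that it passes directly to `L²` limits. -/
theorem integral_mul_reflect_eq {g : ℝ → ℝ} (h1 : Integrable g) (h2 : MemLp g 2) (t s : ℝ) :
    ((∫ u, g (t - u) * g (s - u) : ℝ) : ℂ) =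
      ∫ l : ℝ, inner ℂ (((Real.sqrt (2 * Real.pi))⁻¹ : ℂ) * 𝓕 (fun u => (g u : ℂ)) (l / (2 * Real.pi)))
        (Complex.exp (Complex.I * (l : ℂ) * ((s - t : ℝ) : ℂ)) *
        (((Real.sqrt (2 * Real.pi))⁻¹ : ℂ) * 𝓕 (fun u => (g u : ℂ)) (l / (2 * Real.pi)))) := by
  have hmp : ∀ t : ℝ, MeasurePreserving (fun u : ℝ => t - u) volume volume :=
    fun t => Measure.measurePreserving_sub_left volume t
  have i1 : ∀ t, Integrable (fun u => ((g (t - u) : ℝ) : ℂ)) := fun t =>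
    ((hmp t).integrable_comp_of_integrable h1).ofReal
  have i2 : ∀ t, MemLp (fun u => ((g (t - u) : ℝ) : ℂ)) 2 := fun t =>
    (h2.comp_measurePreserving (hmp t)).ofReal
  have h := integral_conj_fourier_mul (i1 s) (i2 s) (i1 t) (i2 t)
  have e1 : ((∫ u, g (t - u) * g (s - u) : ℝ) : ℂ) =
      ∫ x, (starRingEnd ℂ) ((g (s - x) : ℝ) : ℂ) * ((g (t - x) : ℝ) : ℂ) := by
    rw [← integral_complex_ofReal]
    refine integral_congr_ae (Eventually.of_forall fun u => ?_)
    simp [mul_comm]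
  rw [e1, ← h]
  have e2 : ∀ l : ℝ, inner ℂ (((Real.sqrt (2 * Real.pi))⁻¹ : ℂ) * 𝓕 (fun u => (g u : ℂ)) (l / (2 * Real.pi)))
        (Complex.exp (Complex.I * (l : ℂ) * ((s - t : ℝ) : ℂ)) *
        (((Real.sqrt (2 * Real.pi))⁻¹ : ℂ) * 𝓕 (fun u => (g u : ℂ)) (l / (2 * Real.pi)))) =
      (2 * Real.pi : ℂ)⁻¹ * (fun x : ℝ => (starRingEnd ℂ) (𝓕 (fun u => ((g (s - u) : ℝ) : ℂ)) x) *
        𝓕 (fun u => ((g (t - u) : ℝ) : ℂ)) x) (l / (2 * Real.pi)) := by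
    intro l
    simp only [RCLike.inner_apply, fourier_reflect_translate]
    have hl : 2 * Real.pi * (l / (2 * Real.pi)) = l := by field_simp
    rw [hl]
    have hs : ((Real.sqrt (2 * Real.pi))⁻¹ : ℂ) * ((Real.sqrt (2 * Real.pi))⁻¹ : ℂ) = (2 * Real.pi : ℂ)⁻¹ := by
      rw [← mul_inv, ← Complex.ofReal_mul, Real.mul_self_sqrt (by positivity)]
      push_cast; rfl
    have he : Complex.exp (Complex.I * (l : ℂ) * ((s - t : ℝ) : ℂ)) =
       Complex.exp (Complex.I * (l : ℂ) * (s : ℂ)) * Complex.exp (-(Complex.I * (l : ℂ) * (t : ℂ))) := by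
      rw [← Complex.exp_add]; congr 1; push_cast; ring
    simp only [map_mul, map_inv₀, Complex.conj_ofReal, ← Complex.exp_conj, map_neg, Complex.conj_I,
      Complex.conj_conj, he, neg_mul, neg_neg, ← hs]
    ring
  simp_rw [e2]
  rw [integral_const_mul, Measure.integral_comp_div (fun x : ℝ => (starRingEnd ℂ) (𝓕 (fun u => ((g (s - u) : ℝ) : ℂ)) x) *
        𝓕 (fun u => ((g (t - u) : ℝ) : ℂ)) x), abs_of_pos (by positivity)]
  rw [Complex.real_smul, ← mul_assoc]
  push_cast
  rw [inv_mul_cancel₀ (by simp [Real.pi_ne_zero]), one_mul]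

theorem memLp_transfer {g : ℝ → ℝ} (h1 : Integrable g) (h2 : MemLp g 2) :
    MemLp (fun l : ℝ => ((Real.sqrt (2 * Real.pi))⁻¹ : ℂ) *
      𝓕 (fun u => (g u : ℂ)) (l / (2 * Real.pi))) 2 := by
  refine MemLp.const_mul ?_ _
  have hc : Continuous (𝓕 (fun u => (g u : ℂ)) : ℝ → ℂ) :=
    VectorFourier.fourierIntegral_continuous (L := innerₗ ℝ) Real.continuous_fourierChar
      (by exact continuous_inner) h1.ofReal
  have hm : Continuous fun l : ℝ => 𝓕 (fun u => (g u : ℂ)) (l / (2 * Real.pi)) :=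
    hc.comp (continuous_id.div_const _)
  rw [memLp_two_iff_integrable_sq_norm hm.aestronglyMeasurable]
  exact ((memLp_fourier h1.ofReal h2.ofReal).integrable_norm_pow (by norm_num)).comp_div
    (by positivity)

/-- The moving average covariance has spectral density `|h|²`. -/
theorem IsTransferFunction.integral_mul_reflect {ψ : ℝ → ℝ} {h : ℝ → ℂ}
    (hh : IsTransferFunction ψ h) (hψ : MemLp ψ 2) (h0 : ∀ t, t < 0 → ψ t = 0) (t s : ℝ) :
    ((∫ u, ψ (t - u) * ψ (s - u) : ℝ) : ℂ) =
      ∫ l : ℝ, Complex.exp (Complex.I * (l : ℂ) * ((s - t : ℝ) : ℂ)) * ((‖h l‖ ^ 2 : ℝ) : ℂ) := by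
  -- A square integrable `ψ` need not be integrable. Its truncations to `[0, N]` are, and their
  -- scaled transforms are exactly the functions converging to `h` in the definition of the transfer
  -- function.
  set g : ℕ → ℝ → ℝ := fun N => (Icc 0 (N : ℝ)).indicator ψ with hgdef
  have hg2 : ∀ N, MemLp (g N) 2 := fun N => hψ.indicator measurableSet_Icc
  have hg1 : ∀ N, Integrable (g N) := fun N => by
    rw [hgdef, integrable_indicator_iff measurableSet_Icc]
    exact (hψ.restrict _).integrable one_le_two
  set H : ℕ → ℝ → ℂ := fun N l => ((Real.sqrt (2 * Real.pi))⁻¹ : ℂ) *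
      𝓕 (fun u => (g N u : ℂ)) (l / (2 * Real.pi)) with hHdef
  have hH : ∀ N, MemLp (H N) 2 := fun N => memLp_transfer (hg1 N) (hg2 N)
  have hlim : Tendsto (fun N => eLpNorm (h - H N) 2 volume) atTop (𝓝 0) := by
    refine (hh.2.comp tendsto_natCast_atTop_atTop).congr fun N => ?_
    simp only [Function.comp]
    congr 1
    ext l
    simp only [Pi.sub_apply, hHdef]
    congr 2
    rw [fourier_div_two_pi, intervalIntegral.integral_of_le (Nat.cast_nonneg N),
      ← integral_Icc_eq_integral_Ioc, ← integral_indicator measurableSet_Icc]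
    congr 1
    ext u
    by_cases hu : u ∈ Icc 0 (N : ℝ) <;> simp [hgdef, hu]
  have hnorm : ∀ l : ℝ, ‖Complex.exp (Complex.I * (l : ℂ) * ((s - t : ℝ) : ℂ))‖ = 1 := by
    intro l; rw [Complex.norm_exp]; simp
  have hemeas : AEStronglyMeasurable
      (fun l : ℝ => Complex.exp (Complex.I * (l : ℂ) * ((s - t : ℝ) : ℂ))) volume :=
    Continuous.aestronglyMeasurable (by fun_prop)
  have hE : ∀ F : ℝ → ℂ, MemLp F 2 →
      MemLp (fun l : ℝ => Complex.exp (Complex.I * (l : ℂ) * ((s - t : ℝ) : ℂ)) * F l) 2 := by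
    intro F hF
    refine hF.congr_norm (hemeas.mul hF.1) (Eventually.of_forall fun l => ?_)
    rw [norm_mul, hnorm, one_mul]
  have hlimE : Tendsto (fun N => eLpNorm
      ((fun l : ℝ => Complex.exp (Complex.I * (l : ℂ) * ((s - t : ℝ) : ℂ)) * h l) -
      (fun l : ℝ => Complex.exp (Complex.I * (l : ℂ) * ((s - t : ℝ) : ℂ)) * H N l)) 2 volume)
      atTop (𝓝 0) := by
    refine hlim.congr fun N => eLpNorm_congr_norm_ae (Eventually.of_forall fun l => ?_)
    simp only [Pi.sub_apply]
    rw [← mul_sub, norm_mul, hnorm, one_mul]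
  have l1 := tendsto_integral_inner (𝕜 := ℂ) hh.1 (hE h hh.1) hH (fun N => hE _ (hH N)) hlim hlimE
  simp_rw [hHdef, ← fun N => integral_mul_reflect_eq (hg1 N) (hg2 N) t s] at l1
  have l2 : Tendsto (fun N : ℕ => ((∫ u, g N (t - u) * g N (s - u) : ℝ) : ℂ)) atTop
      (𝓝 ((∫ u, ψ (t - u) * ψ (s - u) : ℝ) : ℂ)) := by
    refine (Complex.continuous_ofReal.tendsto _).comp ?_
    have hmp : ∀ t : ℝ, MeasurePreserving (fun u : ℝ => t - u) volume volume :=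
      fun t => Measure.measurePreserving_sub_left volume t
    have hle : ∀ N u, ‖g N u‖ ≤ ‖ψ u‖ := fun N u => norm_indicator_le_norm_self _ _
    refine tendsto_integral_of_dominated_convergence (fun u => ‖ψ (t - u) * ψ (s - u)‖)
      (fun N => ?_) ?_ (fun N => Eventually.of_forall fun u => ?_)
      (Eventually.of_forall fun u => ?_)
    · exact (((hg2 N).comp_measurePreserving (hmp t)).integrable_mul
        ((hg2 N).comp_measurePreserving (hmp s))).1
    · exact ((hψ.comp_measurePreserving (hmp t)).integrable_mul
        (hψ.comp_measurePreserving (hmp s))).norm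
    · rw [norm_mul, norm_mul]
      exact mul_le_mul (hle _ _) (hle _ _) (norm_nonneg _) (norm_nonneg _)
    -- Causality matters here: truncation to `[0, N]` recovers `ψ` in the limit only because `ψ`
    -- vanishes on the negative half-line.
    · have hp : ∀ x, Tendsto (fun N : ℕ => g N x) atTop (𝓝 (ψ x)) := by
        intro x
        refine tendsto_const_nhds.congr' ?_
        filter_upwards [eventually_ge_atTop ⌈x⌉₊] with N hN
        by_cases hx : x < 0
        · simp [hgdef, indicator, h0 x hx]
        · have : x ∈ Icc 0 (N : ℝ) := ⟨not_lt.1 hx, (Nat.le_ceil x).trans (by exact_mod_cast hN)⟩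
          simp [hgdef, this]
      exact (hp _).mul (hp _)
  rw [tendsto_nhds_unique l2 l1]
  refine integral_congr_ae (Eventually.of_forall fun l => ?_)
  simp only [RCLike.inner_apply]
  rw [mul_assoc, Complex.mul_conj, Complex.normSq_eq_norm_sq]

/-! ### Riemann sums and sub-Gaussian integrals of the noise -/

/-- Stated for Banach values because the same sums are used twice: along individual paths, and in
`L²(Ω)` to find the limiting variance. -/
theorem tendsto_riemannSum {E : Type*} [NormedAddCommGroup E] [NormedSpace ℝ E] [CompleteSpace E]
    {T : ℝ} (hT : 0 < T) {F : ℝ → E} (hF : ContinuousOn F (Icc 0 T)) :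
    Tendsto (fun n : ℕ => ∑ i ∈ Finset.range n, (T / n) • F (i * (T / n))) atTop
      (𝓝 (∫ t in (0 : ℝ)..T, F t)) := by
  rw [Metric.tendsto_atTop]
  intro η hη
  have huc := isCompact_Icc.uniformContinuousOn_of_continuous hF
  rw [Metric.uniformContinuousOn_iff] at huc
  obtain ⟨δ, hδ, hδF⟩ := huc (η / (2 * T)) (by positivity)
  obtain ⟨N, hN⟩ := exists_nat_gt (T / δ)
  refine ⟨N + 1, fun n hn => ?_⟩
  have hn0 : (0 : ℝ) < n := by exact_mod_cast (Nat.succ_pos N).trans_le hn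
  have hstep : T / n < δ := by
    rw [div_lt_iff₀ hn0]
    rw [div_lt_iff₀ hδ] at hN
    have : (N : ℝ) ≤ n := by exact_mod_cast (Nat.le_succ N).trans hn
    nlinarith
  have hpos : 0 < T / n := by positivity
  set a : ℕ → ℝ := fun i => i * (T / n) with ha
  have ha0 : a 0 = 0 := by simp [ha]
  have han : a n = T := by simp only [ha]; field_simp
  have hmono : Monotone a := fun i j hij => by
    simp only [ha]; gcongr
  have hsucc : ∀ i, a (i + 1) - a i = T / n := fun i => by simp only [ha]; push_cast; ring
  have hsub : ∀ i < n, uIcc (a i) (a (i + 1)) ⊆ Icc 0 T := fun i hi => by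
    rw [uIcc_of_le (hmono (Nat.le_succ i))]
    refine Icc_subset_Icc ?_ ?_
    · rw [← ha0]; exact hmono (Nat.zero_le i)
    · rw [← han]; exact hmono hi
  have hint : ∀ i < n, IntervalIntegrable F volume (a i) (a (i + 1)) := fun i hi =>
    (hF.mono (hsub i hi)).intervalIntegrable
  have hsum := intervalIntegral.sum_integral_adjacent_intervals hint
  rw [ha0, han] at hsum
  rw [dist_eq_norm, ← hsum, ← Finset.sum_sub_distrib]
  have hterm : ∀ i ∈ Finset.range n, ‖(T / n) • F (a i) - ∫ t in a i..a (i + 1), F t‖ ≤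
      η / (2 * T) * (T / n) := by
    intro i hi
    have hi := Finset.mem_range.1 hi
    have e : (T / n) • F (a i) - ∫ t in a i..a (i + 1), F t =
        ∫ t in a i..a (i + 1), (F (a i) - F t) := by
      rw [intervalIntegral.integral_sub intervalIntegrable_const (hint i hi),
        intervalIntegral.integral_const, hsucc]
    rw [e]
    have := intervalIntegral.norm_integral_le_of_norm_le_const (a := a i) (b := a (i + 1))
      (f := fun t => F (a i) - F t) (C := η / (2 * T)) (fun t ht => ?_)
    · rwa [hsucc, abs_of_pos hpos] at this
    · have ht' := uIoc_subset_uIcc ht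
      have h1 : a i ∈ Icc 0 T := hsub i hi left_mem_uIcc
      have h2 : t ∈ Icc 0 T := hsub i hi ht'
      rw [uIcc_of_le (hmono (Nat.le_succ i))] at ht'
      have h3 : dist (a i) t < δ := by
        rw [Real.dist_eq, abs_lt]
        have := hsucc i
        constructor <;> linarith [ht'.1, ht'.2]
      have := hδF _ h1 _ h2 h3
      rw [dist_eq_norm] at this
      exact this.le
  calc ‖∑ i ∈ Finset.range n, ((T / n) • F (i * (T / n)) - ∫ t in a i..a (i + 1), F t)‖
      ≤ ∑ i ∈ Finset.range n, η / (2 * T) * (T / n) := norm_sum_le_of_le _ hterm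
    _ = η / 2 := by
        rw [Finset.sum_const, Finset.card_range, nsmul_eq_mul]; field_simp
    _ < η := by linarith

theorem norm_intervalIntegral_sq {E : Type*} [NormedAddCommGroup E] [InnerProductSpace ℝ E]
    [CompleteSpace E] {a b : ℝ} {F : ℝ → E} (hF : IntervalIntegrable F volume a b) :
    ‖∫ t in a..b, F t‖ ^ 2 = ∫ t in a..b, ∫ s in a..b, inner ℝ (F t) (F s) := by
  rw [← real_inner_self_eq_norm_sq]
  have h1 := (innerSL ℝ (∫ t in a..b, F t)).intervalIntegral_comp_comm hF
  simp only [innerSL_apply_apply] at h1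
  rw [← h1]
  refine intervalIntegral.integral_congr fun t _ => ?_
  have h2 := (innerSL ℝ (F t)).intervalIntegral_comp_comm hF
  simp only [innerSL_apply_apply] at h2
  rw [h2, real_inner_comm]

/-- Extending `Δ` by zero outside `(0, T]` reduces the form on the interval to the form on the line.
-/
theorem spectral_interval_form_le {f : ℝ → ℝ} (hf : Integrable f) {M : ℝ} (h0 : ∀ l, 0 ≤ f l)
    (hM : ∀ l, f l ≤ M) {K : ℝ → ℝ → ℝ}
    (hK : ∀ t s, ((K t s : ℝ) : ℂ) =
      ∫ l : ℝ, Complex.exp (Complex.I * (l : ℂ) * ((s - t : ℝ) : ℂ)) * (f l : ℂ))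
    {T : ℝ} (hT : 0 < T) {Δ : ℝ → ℝ} (hΔ : ContinuousOn Δ (Icc 0 T)) :
    (∫ t in (0 : ℝ)..T, ∫ s in (0 : ℝ)..T, K t s * Δ t * Δ s) ≤
      2 * Real.pi * M * ∫ t in (0 : ℝ)..T, Δ t ^ 2 := by
  have hΔi : IntegrableOn Δ (Ioc 0 T) :=
    (hΔ.integrableOn_compact isCompact_Icc).mono_set Ioc_subset_Icc_self
  have hΔi2 : IntegrableOn (fun t => Δ t ^ 2) (Ioc 0 T) :=
    ((hΔ.pow 2).integrableOn_compact isCompact_Icc).mono_set Ioc_subset_Icc_self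
  have h2 : MemLp ((Ioc 0 T).indicator Δ) 2 := by
    rw [memLp_indicator_iff_restrict measurableSet_Ioc, memLp_two_iff_integrable_sq hΔi.1]
    exact hΔi2
  have := spectral_quadratic_form_le hf h0 hM (K := K)
    ((integrable_indicator_iff measurableSet_Ioc).2 hΔi) h2 hK
  have e1 : ∀ F : ℝ → ℝ, ∫ t in (0 : ℝ)..T, F t = ∫ t, (Ioc 0 T).indicator F t := fun F => by
    rw [intervalIntegral.integral_of_le hT.le, integral_indicator measurableSet_Ioc]
  have e2 : ∀ t, (Ioc 0 T).indicator (fun t => ∫ s in (0 : ℝ)..T, K t s * Δ t * Δ s) t =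
      ∫ s, K t s * (Ioc 0 T).indicator Δ t * (Ioc 0 T).indicator Δ s := by
    intro t
    by_cases ht : t ∈ Ioc 0 T
    · rw [indicator_of_mem ht, e1]
      refine integral_congr_ae (Eventually.of_forall fun s => ?_)
      by_cases hs : s ∈ Ioc 0 T
      · simp only [indicator_of_mem hs, indicator_of_mem ht]
      · simp only [indicator_of_notMem hs, mul_zero]
    · simp [indicator_of_notMem ht]
  have e3 : ∀ t, (Ioc 0 T).indicator (fun t => Δ t ^ 2) t = (Ioc 0 T).indicator Δ t ^ 2 := by
    intro t
    by_cases ht : t ∈ Ioc 0 T <;> simp [ht]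
  rw [e1, e1]
  simp_rw [e2, e3]
  exact this

section
variable {Ω : Type*} [MeasurableSpace Ω] {P : Measure Ω} {ε : ℝ → Ω → ℝ}

theorem NoiseCondition.nonneg {d₀ : ℝ} (h : NoiseCondition P ε d₀) : 0 ≤ d₀ := by
  rcases h with ⟨-, h⟩ | ⟨-, f, hf, -, rfl⟩ | ⟨ξ, ψ, h, -, -, -, rfl⟩
  · exact h.1.le
  · exact mul_nonneg (by positivity) (Real.iSup_nonneg hf.density_nonneg)
  · exact mul_nonneg (by positivity) (Real.iSup_nonneg fun l => by positivity)

theorem NoiseCondition.of_mem_span {d₀ : ℝ} (h : NoiseCondition P ε d₀)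
    (hε : ∀ t, MemLp (ε t) 2 P) {X : Ω → ℝ} (hX : X ∈ Submodule.span ℝ (range ε)) :
    IsStrictlySubGaussianRV P X := by
  rcases h with ⟨h, -⟩ | ⟨h, -⟩ | ⟨ξ, ψ, k, h, -⟩
  · exact h.of_mem_span hε hX
  · exact h.of_mem_span hε hX
  · exact h.of_mem_span hε hX

theorem NoiseCondition.covariance_form_le {d₀ : ℝ} (h : NoiseCondition P ε d₀)
    (hε : ∀ t, MemLp (ε t) 2 P) {T : ℝ} (hT : 0 < T) {Δ : ℝ → ℝ}
    (hΔ : ContinuousOn Δ (Icc 0 T)) :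
    (∫ t in (0 : ℝ)..T, ∫ s in (0 : ℝ)..T, covFun P ε t s * Δ t * Δ s) ≤
      d₀ * ∫ t in (0 : ℝ)..T, Δ t ^ 2 := by
  rcases h with ⟨-, h⟩ | ⟨-, f, hf, hb, rfl⟩ | ⟨ξ, ψ, k, h, hk, hb, rfl⟩
  · refine h.2 T hT Δ ?_
    rw [memLp_two_iff_integrable_sq (hΔ.aestronglyMeasurable measurableSet_Icc)]
    exact (hΔ.pow 2).integrableOn_compact isCompact_Icc
  · refine spectral_interval_form_le hf.density_integrable hf.density_nonneg (le_ciSup hb)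
      (fun t s => ?_) hT hΔ
    have := hf.stationary 0 (s - t) t
    rw [zero_add, sub_add_cancel] at this
    rw [this, hf.spectral]
  · refine spectral_interval_form_le (f := fun l => ‖k l‖ ^ 2)
      (hk.1.integrable_norm_pow (by norm_num)) (fun l => by positivity) (le_ciSup hb)
      (fun t s => ?_) hT hΔ
    rw [h.covFun_eq hε, hk.integral_mul_reflect h.kernel_memLp h.kernel_causal]

open ProbabilityTheory in
/-- `∫₀ᵀ ε Δ` is sub-Gaussian with variance proxy `d₀ ∫₀ᵀ Δ²`. -/
theorem NoiseCondition.hasSubgaussianMGF_integral {d₀ : ℝ} (h : NoiseCondition P ε d₀)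
    (hε : IsContinuousCentredNoise P ε) {T : ℝ} (hT : 0 < T) {Δ : ℝ → ℝ}
    (hΔ : ContinuousOn Δ (Icc 0 T)) {v : NNReal} (hv : d₀ * ∫ t in (0 : ℝ)..T, Δ t ^ 2 ≤ v) :
    HasSubgaussianMGF (fun ω => ∫ t in (0 : ℝ)..T, ε t ω * Δ t) v P := by
  have hL := hε.mean_square_continuous.1
  set R : ℕ → Ω → ℝ := fun n => ∑ i ∈ Finset.range n,
    (T / n) • (Δ (i * (T / n)) • ε (i * (T / n))) with hR
  have hRspan : ∀ n, R n ∈ Submodule.span ℝ (range ε) := fun n =>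
    Submodule.sum_mem _ fun i _ => Submodule.smul_mem _ _ (Submodule.smul_mem _ _
      (Submodule.subset_span (mem_range_self _)))
  have hRlim : ∀ᵐ ω ∂P, Tendsto (fun n => R n ω) atTop (𝓝 (∫ t in (0 : ℝ)..T, ε t ω * Δ t)) := by
    filter_upwards [hε.ae_continuous] with ω hω
    refine (tendsto_riemannSum hT (hω.continuousOn.mul hΔ)).congr fun n => ?_
    simp [hR, Finset.sum_apply, mul_comm]
  have hRm : ∀ n, MemLp (R n) 2 P := fun n => (h.of_mem_span hL (hRspan n)).memLp
  have hsq : ∀ {u : Ω → ℝ} (hu : MemLp u 2 P), ∫ ω, u ω ^ 2 ∂P = ‖hu.toLp u‖ ^ 2 := by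
    intro u hu
    rw [← real_inner_self_eq_norm_sq, L2.inner_def]
    refine integral_congr_ae ?_
    filter_upwards [hu.coeFn_toLp] with x hx
    rw [hx]; simp [pow_two]
  have hcov : ∀ t s, inner ℝ ((hL t).toLp (ε t)) ((hL s).toLp (ε s)) = covFun P ε t s := by
    intro t s
    rw [L2.inner_def]
    refine integral_congr_ae ?_
    filter_upwards [(hL t).coeFn_toLp, (hL s).coeFn_toLp] with x hx hy
    rw [hx, hy]; simp [mul_comm]
  have hcont : Continuous fun t => (hL t).toLp (ε t) := by
    rw [continuous_iff_continuousAt]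
    intro t₀
    rw [ContinuousAt, tendsto_iff_norm_sub_tendsto_zero]
    have h1 : ∀ t, ‖(hL t).toLp (ε t) - (hL t₀).toLp (ε t₀)‖ =
        Real.sqrt (∫ ω, (ε t ω - ε t₀ ω) ^ 2 ∂P) := by
      intro t
      have := hsq ((hL t).sub (hL t₀))
      simp only [Pi.sub_apply] at this
      rw [this, Real.sqrt_sq (norm_nonneg _), MemLp.toLp_sub]
    simp_rw [h1]
    have := (hε.mean_square_continuous.2 t₀).sqrt
    rwa [Real.sqrt_zero] at this
  -- Mean-square continuity makes `F` a continuous curve in `L²(Ω)`. The variance of the Riemann sum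
  -- is the squared norm of a vector Riemann sum of `F`, so it tends to the squared norm of `∫ F`,
  -- which is the covariance form.
  set F : ℝ → Lp ℝ 2 P := fun t => Δ t • (hL t).toLp (ε t) with hF
  have hFc : ContinuousOn F (Icc 0 T) := hΔ.smul hcont.continuousOn
  have hRL : ∀ n : ℕ, (hRm n).toLp (R n) =
      ∑ i ∈ Finset.range n, (T / n) • F (i * (T / n)) := by
    intro n
    refine Lp.ext ?_
    refine (hRm n).coeFn_toLp.trans ?_
    have h1 : ∀ t, (F t : Ω → ℝ) =ᵐ[P] Δ t • ε t := fun t => by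
      filter_upwards [Lp.coeFn_smul (Δ t) ((hL t).toLp (ε t)), (hL t).coeFn_toLp] with x hx hy
      rw [hF]; simp only; rw [hx, Pi.smul_apply, hy, Pi.smul_apply]
    have h2 : ∀ m : Finset ℕ, (↑(∑ i ∈ m, (T / n) • F (i * (T / n))) : Ω → ℝ) =ᵐ[P]
        ∑ i ∈ m, (T / n) • (Δ (i * (T / n)) • ε (i * (T / n))) := by
      intro m
      induction m using Finset.induction_on with
      | empty => simpa using Lp.coeFn_zero ℝ 2 P
      | insert a m ha ih =>
        rw [Finset.sum_insert ha, Finset.sum_insert ha]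
        filter_upwards [Lp.coeFn_add ((T / n) • F (a * (T / n)))
          (∑ i ∈ m, (T / n) • F (i * (T / n))), ih, h1 (a * (T / n)),
          Lp.coeFn_smul (T / n : ℝ) (F (a * (T / n)))] with x h3 h4 h5 h6
        rw [h3, Pi.add_apply, Pi.add_apply, h4, h6, Pi.smul_apply, Pi.smul_apply, h5]
    exact (h2 _).symm
  have hvar : Tendsto (fun n => ∫ ω, R n ω ^ 2 ∂P) atTop
      (𝓝 (∫ t in (0 : ℝ)..T, ∫ s in (0 : ℝ)..T, covFun P ε t s * Δ t * Δ s)) := by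
    have hFi : IntervalIntegrable F volume 0 T := by
      refine ContinuousOn.intervalIntegrable ?_
      rwa [uIcc_of_le hT.le]
    have h1 := ((tendsto_riemannSum hT hFc).norm).pow 2
    rw [norm_intervalIntegral_sq hFi] at h1
    have h2 : ∀ t s, inner ℝ (F t) (F s) = covFun P ε t s * Δ t * Δ s := by
      intro t s
      simp only [hF, real_inner_smul_left, real_inner_smul_right, hcov]; ring
    simp_rw [h2] at h1
    refine h1.congr fun n => ?_
    rw [hsq (hRm n), hRL]
  have hcle := h.covariance_form_le hL hT hΔ
  have hXm : AEStronglyMeasurable (fun ω => ∫ t in (0 : ℝ)..T, ε t ω * Δ t) P :=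
    aestronglyMeasurable_of_tendsto_ae atTop (fun n => (hRm n).1) hRlim
  have main : ∀ l : ℝ, Integrable (fun ω => Real.exp (l * ∫ t in (0 : ℝ)..T, ε t ω * Δ t)) P ∧
      ∫ ω, Real.exp (l * ∫ t in (0 : ℝ)..T, ε t ω * Δ t) ∂P ≤
        Real.exp (l ^ 2 * (∫ t in (0 : ℝ)..T, ∫ s in (0 : ℝ)..T, covFun P ε t s * Δ t * Δ s) / 2) := by
    intro l
    have hsg : ∀ n, IsStrictlySubGaussianRV P (l • R n) := fun n =>
      h.of_mem_span hL (Submodule.smul_mem _ _ (hRspan n))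
    refine integral_exp_le_of_tendsto_ae (Xs := fun n => l • R n)
      (vs := fun n => l ^ 2 * (∫ ω, R n ω ^ 2 ∂P) / 2) (hXm.const_mul l)
      (fun n => (hsg n).integrable_exp) (fun n => (hsg n).integral_exp_le.trans (le_of_eq ?_)) ?_ ?_
    · rw [← integral_const_mul]
      simp only [Pi.smul_apply, smul_eq_mul, mul_pow]
    · filter_upwards [hRlim] with ω hω
      exact hω.const_mul l
    · exact (hvar.const_mul _).div_const _
  refine ⟨fun l => (main l).1, fun l => (main l).2.trans (Real.exp_le_exp.2 ?_)⟩
  have := hcle.trans hv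
  nlinarith [sq_nonneg l, mul_le_mul_of_nonneg_left this (sq_nonneg l)]
end

/-! ### Dyadic chaining -/

theorem summable_pow_mul_exp_neg_pow (q : ℕ) {c : ℝ} (hc : 0 < c) :
    Summable fun n : ℕ => (2 : ℝ) ^ q * ((4 : ℝ) ^ q) ^ n * Real.exp (-(c * (9 / 4) ^ n)) := by
  -- The bound `e^{-z} ≤ j!/z^j` at this `j` gains `(9/4)^{jn}`, which beats the entropy `4^{qn}`
  -- with a factor `2^n` to spare.
  obtain ⟨j, hj⟩ := pow_unbounded_of_one_lt (2 * (4 : ℝ) ^ q) (by norm_num : (1 : ℝ) < 9 / 4)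
  refine Summable.of_nonneg_of_le (fun n => by positivity) (fun n => ?_)
    ((summable_geometric_of_lt_one (r := 1 / 2) (by norm_num) (by norm_num)).mul_left
      ((2 : ℝ) ^ q * (j.factorial / c ^ j)))
  have hz : 0 < c * (9 / 4) ^ n := by positivity
  have h1 : Real.exp (-(c * (9 / 4) ^ n)) ≤ j.factorial / (c * (9 / 4) ^ n) ^ j := by
    rw [Real.exp_neg, inv_le_comm₀ (Real.exp_pos _) (by positivity), inv_div]
    exact Real.pow_div_factorial_le_exp _ hz.le j
  have h2 : ((4 : ℝ) ^ q) ^ n ≤ (1 / 2) ^ n * ((9 / 4) ^ j) ^ n := by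
    rw [← mul_pow]
    exact pow_le_pow_left₀ (by positivity) (by linarith) n
  calc (2 : ℝ) ^ q * ((4 : ℝ) ^ q) ^ n * Real.exp (-(c * (9 / 4) ^ n))
      ≤ (2 : ℝ) ^ q * ((1 / 2) ^ n * ((9 / 4) ^ j) ^ n) * (j.factorial / (c * (9 / 4) ^ n) ^ j) := by
        gcongr
    _ = (2 : ℝ) ^ q * (j.factorial / c ^ j) * (1 / 2) ^ n := by
        have : ((9 / 4 : ℝ) ^ n) ^ j = ((9 / 4) ^ j) ^ n := by rw [← pow_mul, ← pow_mul, mul_comm]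
        rw [mul_pow, this]
        field_simp

theorem abs_sub_le_of_floor_eq {n : ℕ} {x y : ℝ} (h : ⌊(2 : ℝ) ^ n * x⌋ = ⌊(2 : ℝ) ^ n * y⌋) :
    |x - y| ≤ (1 / 2) ^ n := by
  have h1 := Int.abs_sub_lt_one_of_floor_eq_floor h
  rw [← mul_sub, abs_mul, abs_of_pos (by positivity : (0 : ℝ) < 2 ^ n)] at h1
  rw [one_div, inv_pow, ← one_div, le_div_iff₀ (by positivity)]
  linarith

theorem euclidean_norm_sq_le {q : ℕ} {x : EuclideanSpace ℝ (Fin q)} {r : ℝ}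
    (h : ∀ i, |x i| ≤ r) : ‖x‖ ^ 2 ≤ q * r ^ 2 := by
  rw [EuclideanSpace.norm_sq_eq]
  calc ∑ i, ‖x i‖ ^ 2 ≤ ∑ _i : Fin q, r ^ 2 := by
        refine Finset.sum_le_sum fun i _ => ?_
        exact pow_le_pow_left₀ (norm_nonneg _) (h i) 2
    _ = q * r ^ 2 := by simp

theorem sum_quarter_geometric (N : ℕ) :
    ∑ n ∈ Finset.range N, (1 / 4 : ℝ) * (3 / 4) ^ n = 1 - (3 / 4) ^ N := by
  induction N with
  | zero => simp
  | succ N ih => rw [Finset.sum_range_succ, ih, pow_succ]; ring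

open ProbabilityTheory in
/-- Dyadic chaining over one unit cell for a process with sub-Gaussian increments. -/
theorem exists_chaining_tail {Ω : Type*} [MeasurableSpace Ω] (P : Measure Ω)
    [IsProbabilityMeasure P] (q : ℕ) {σ : ℝ} (hσ : 0 < σ) :
    ∃ C c : ℝ, 0 < C ∧ 0 < c ∧ ∀ (U : Set (EuclideanSpace ℝ (Fin q)))
      (Y : EuclideanSpace ℝ (Fin q) → Ω → ℝ) (k : Fin q → ℤ) (u₀ : EuclideanSpace ℝ (Fin q)),
      (∀ u ∈ U, ∀ v ∈ U, ∀ w : NNReal, σ * ‖u - v‖ ^ 2 ≤ w →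
        HasSubgaussianMGF (fun ω => Y u ω - Y v ω) w P) →
      (∀ᵐ ω ∂P, ContinuousOn (fun u => Y u ω) U) →
      (∀ u ∈ U, ∀ i, ⌊u i⌋ = k i) → u₀ ∈ U →
      ∀ y : ℝ, 0 ≤ y → P {ω | ∃ u ∈ U, y < Y u ω - Y u₀ ω} ≤
        ENNReal.ofReal (C * Real.exp (-(c * y ^ 2))) := by
  -- At level `n` the threshold is `(y/4)(3/4)^n` and the variance proxy is `4σ(q+1)(1/4)^n`, so the
  -- exponent is `y² (9/4)^n / (128σ(q+1))`. Using `q + 1` keeps it positive for `q = 0`.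
  set c : ℝ := 1 / (128 * σ * (q + 1)) with hc
  have hcpos : 0 < c := by positivity
  have hsum := summable_pow_mul_exp_neg_pow q (half_pos hcpos)
  set S : ℝ := ∑' n : ℕ, (2 : ℝ) ^ q * ((4 : ℝ) ^ q) ^ n * Real.exp (-(c / 2 * (9 / 4) ^ n)) with hS
  have hS0 : 0 ≤ S := tsum_nonneg fun n => by positivity
  refine ⟨S + Real.exp (c / 2), c / 2, by positivity, by positivity, ?_⟩
  intro U Y k u₀ hsub hcont hcell hu₀ y hy
  -- For `y < 1` the additive constant `exp (c/2)` already makes the bound at least one.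
  rcases lt_or_ge y 1 with hy1 | hy1
  · refine prob_le_one.trans ?_
    rw [ENNReal.one_le_ofReal]
    calc (1 : ℝ) = Real.exp (c / 2) * Real.exp (-(c / 2)) := by rw [← Real.exp_add]; simp
      _ ≤ (S + Real.exp (c / 2)) * Real.exp (-(c / 2 * y ^ 2)) := by
        gcongr
        · linarith
        · exact mul_le_of_le_one_right (by positivity) (pow_le_one₀ hy hy1.le)
  set key : ℕ → EuclideanSpace ℝ (Fin q) → Fin q → ℤ := fun n u i => ⌊(2 : ℝ) ^ n * u i⌋ with hkey
  -- Each dyadic subcell that meets `U` gets a representative in `U`. At level 0 there is a single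
  -- cell, represented by the base point `u₀`, from which every chain starts.
  have hrep : ∃ rep : ℕ → (Fin q → ℤ) → EuclideanSpace ℝ (Fin q), (∀ κ, rep 0 κ = u₀) ∧
      (∀ n κ, rep n κ ∈ U) ∧ ∀ n, ∀ u ∈ U, key n (rep n (key n u)) = key n u := by
    have : ∀ n κ, ∃ r, (n = 0 → r = u₀) ∧ r ∈ U ∧ ∀ u ∈ U, key n u = κ → key n r = κ := by
      intro n κ
      rcases Nat.eq_zero_or_pos n with rfl | hn
      · refine ⟨u₀, fun _ => rfl, hu₀, fun u hu h => ?_⟩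
        rw [← h]; ext i
        simp [hkey, hcell u hu, hcell u₀ hu₀]
      · by_cases h : ∃ u ∈ U, key n u = κ
        · obtain ⟨u, hu, h⟩ := h
          exact ⟨u, fun h0 => absurd h0 hn.ne', hu, fun _ _ _ => h⟩
        · exact ⟨u₀, fun _ => rfl, hu₀, fun u hu h' => absurd ⟨u, hu, h'⟩ h⟩
    choose rep h1 h2 h3 using this
    exact ⟨rep, fun κ => h1 0 κ rfl, h2, fun n u hu => h3 n _ u hu rfl⟩
  obtain ⟨rep, hrep0, hrepU, hrepkey⟩ := hrep
  have hclose : ∀ n, ∀ u ∈ U, ∀ i, |rep n (key n u) i - u i| ≤ (1 / 2) ^ n := fun n u hu i =>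
    abs_sub_le_of_floor_eq (congrFun (hrepkey n u hu) i)
  set labels : ℕ → Finset (Fin q → ℤ) := fun n =>
    Fintype.piFinset fun i => Finset.Ico (2 ^ n * k i) (2 ^ n * (k i + 1)) with hlabels
  have hcard : ∀ n, (labels n).card = (2 ^ n) ^ q := by
    intro n
    rw [hlabels, Fintype.card_piFinset]
    have : ∀ i, (Finset.Ico ((2 : ℤ) ^ n * k i) (2 ^ n * (k i + 1))).card = 2 ^ n := by
      intro i
      rw [Int.card_Ico]
      have : (2 : ℤ) ^ n * (k i + 1) - 2 ^ n * k i = ((2 ^ n : ℕ) : ℤ) := by push_cast; ring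
      rw [this, Int.toNat_natCast]
    simp [this]
  have hmem : ∀ n, ∀ u ∈ U, key n u ∈ labels n := by
    intro n u hu
    rw [hlabels, Fintype.mem_piFinset]
    intro i
    have h1 := Int.floor_eq_iff.1 (hcell u hu i)
    rw [Finset.mem_Ico, Int.le_floor, Int.floor_lt]
    have : (0 : ℝ) < 2 ^ n := by positivity
    push_cast
    constructor
    · exact mul_le_mul_of_nonneg_left h1.1 this.le
    · exact mul_lt_mul_of_pos_left h1.2 this
  -- Only pairs of labels realized by a common point count: this keeps consecutive representatives
  -- within `2 (1/2)^n` in each coordinate. The thresholds `(1/4)(3/4)^n` sum to one.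
  set Bad : ℕ → (Fin q → ℤ) × (Fin q → ℤ) → Set Ω := fun n p =>
    {ω | (∃ u ∈ U, key n u = p.1 ∧ key (n + 1) u = p.2) ∧
      y * (1 / 4 * (3 / 4) ^ n) ≤ Y (rep (n + 1) p.2) ω - Y (rep n p.1) ω} with hBad
  have hBadP : ∀ n p, P (Bad n p) ≤ ENNReal.ofReal (Real.exp (-(c * y ^ 2 * (9 / 4) ^ n))) := by
    intro n p
    by_cases hp : ∃ u ∈ U, key n u = p.1 ∧ key (n + 1) u = p.2
    · have hset : Bad n p = {ω | y * (1 / 4 * (3 / 4) ^ n) ≤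
          Y (rep (n + 1) p.2) ω - Y (rep n p.1) ω} := by
        ext ω; simp only [hBad, mem_ofPred_eq, hp, true_and]
      obtain ⟨u, hu, h1, h2⟩ := hp
      have hd : ‖rep (n + 1) p.2 - rep n p.1‖ ^ 2 ≤ q * (2 * (1 / 2) ^ n) ^ 2 := by
        refine euclidean_norm_sq_le fun i => ?_
        have e1 := hclose n u hu i
        have e2 := hclose (n + 1) u hu i
        rw [h1] at e1
        rw [h2, pow_succ] at e2
        rw [PiLp.sub_apply]
        have e3 : (0 : ℝ) < (1 / 2) ^ n := by positivity
        rw [abs_le] at e1 e2 ⊢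
        constructor <;> linarith [e1.1, e1.2, e2.1, e2.2]
      have hwpos : 0 < σ * ((q + 1) * (2 * (1 / 2) ^ n) ^ 2) := by positivity
      have hw := hsub _ (hrepU (n + 1) p.2) _ (hrepU n p.1)
        (σ * ((q + 1) * (2 * (1 / 2) ^ n) ^ 2)).toNNReal (by
          rw [Real.coe_toNNReal _ hwpos.le]
          refine mul_le_mul_of_nonneg_left (hd.trans ?_) hσ.le
          gcongr; linarith)
      have ht := hw.measure_ge_le (ε := y * (1 / 4 * (3 / 4) ^ n)) (by positivity)
      rw [Real.coe_toNNReal _ hwpos.le] at ht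
      rw [hset, ← ENNReal.ofReal_toReal (measure_ne_top P _)]
      refine ENNReal.ofReal_le_ofReal (ht.trans (le_of_eq ?_))
      congr 1
      have e4 : (9 / 4 : ℝ) ^ n = ((3 / 4) ^ n / (1 / 2) ^ n) ^ 2 := by
        rw [← div_pow, ← pow_mul, mul_comm n 2, pow_mul]; norm_num
      rw [hc, e4]
      field_simp
      norm_num
    · have : Bad n p = ∅ := by
        ext ω; simp only [hBad, mem_ofPred_eq, hp, false_and, mem_empty_iff_false]
      rw [this, measure_empty]
      exact zero_le
  have hincl : ∀ᵐ ω ∂P, ω ∈ {ω | ∃ u ∈ U, y < Y u ω - Y u₀ ω} →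
      ω ∈ ⋃ n, ⋃ p ∈ labels n ×ˢ labels (n + 1), Bad n p := by
    filter_upwards [hcont] with ω hω
    rintro ⟨u, hu, hyu⟩
    by_contra hno
    simp only [mem_iUnion, not_exists] at hno
    have hstep : ∀ n, Y (rep (n + 1) (key (n + 1) u)) ω - Y (rep n (key n u)) ω ≤
        y * (1 / 4 * (3 / 4) ^ n) := by
      intro n
      by_contra hlt
      exact hno n (key n u, key (n + 1) u)
        (Finset.mem_product.2 ⟨hmem n u hu, hmem (n + 1) u hu⟩)
        ⟨⟨u, hu, rfl, rfl⟩, (not_le.1 hlt).le⟩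
    have hN : ∀ N, Y (rep N (key N u)) ω - Y u₀ ω ≤ y := by
      intro N
      have h1 := Finset.sum_range_sub (fun n => Y (rep n (key n u)) ω) N
      rw [hrep0] at h1
      rw [← h1]
      calc _ ≤ ∑ n ∈ Finset.range N, y * (1 / 4 * (3 / 4 : ℝ) ^ n) :=
            Finset.sum_le_sum fun n _ => hstep n
        _ = y * (1 - (3 / 4) ^ N) := by rw [← Finset.mul_sum, sum_quarter_geometric]
        _ ≤ y := by
            have : (0 : ℝ) ≤ (3 / 4) ^ N := by positivity
            nlinarith
    have hlim : Tendsto (fun N => rep N (key N u)) atTop (𝓝 u) := by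
      rw [tendsto_iff_norm_sub_tendsto_zero]
      have h1 : ∀ N, ‖rep N (key N u) - u‖ ≤ Real.sqrt q * (1 / 2) ^ N := by
        intro N
        have := euclidean_norm_sq_le (x := rep N (key N u) - u) (hclose N u hu)
        rw [← Real.sqrt_sq (norm_nonneg (rep N (key N u) - u)),
          ← Real.sqrt_sq (by positivity : (0 : ℝ) ≤ (1 / 2) ^ N), ← Real.sqrt_mul (by positivity)]
        exact Real.sqrt_le_sqrt this
      refine squeeze_zero (fun _ => norm_nonneg _) h1 ?_
      have := (tendsto_pow_atTop_nhds_zero_of_lt_one (r := (1 / 2 : ℝ)) (by norm_num)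
        (by norm_num)).const_mul (Real.sqrt q)
      rwa [mul_zero] at this
    have hYlim : Tendsto (fun N => Y (rep N (key N u)) ω) atTop (𝓝 (Y u ω)) :=
      (hω u hu).tendsto.comp (tendsto_nhdsWithin_iff.2
        ⟨hlim, Eventually.of_forall fun N => hrepU _ _⟩)
    have := le_of_tendsto (hYlim.sub_const (Y u₀ ω)) (Eventually.of_forall hN)
    linarith
  calc P {ω | ∃ u ∈ U, y < Y u ω - Y u₀ ω}
      ≤ P (⋃ n, ⋃ p ∈ labels n ×ˢ labels (n + 1), Bad n p) := measure_mono_ae hincl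
    _ ≤ ∑' n, P (⋃ p ∈ labels n ×ˢ labels (n + 1), Bad n p) := measure_iUnion_le _
    _ ≤ ∑' n : ℕ, ENNReal.ofReal (Real.exp (-(c / 2 * y ^ 2)) *
          ((2 : ℝ) ^ q * ((4 : ℝ) ^ q) ^ n * Real.exp (-(c / 2 * (9 / 4) ^ n)))) := by
        refine ENNReal.tsum_le_tsum fun n => ?_
        calc P (⋃ p ∈ labels n ×ˢ labels (n + 1), Bad n p)
            ≤ ∑ p ∈ labels n ×ˢ labels (n + 1), P (Bad n p) := measure_biUnion_finset_le _ _
          _ ≤ ∑ p ∈ labels n ×ˢ labels (n + 1),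
              ENNReal.ofReal (Real.exp (-(c * y ^ 2 * (9 / 4) ^ n))) :=
              Finset.sum_le_sum fun p _ => hBadP n p
          _ = ENNReal.ofReal ((2 : ℝ) ^ q * ((4 : ℝ) ^ q) ^ n *
              Real.exp (-(c * y ^ 2 * (9 / 4) ^ n))) := by
              rw [Finset.sum_const, Finset.card_product, hcard, hcard, nsmul_eq_mul,
                ENNReal.ofReal_mul (by positivity)]
              congr 1
              rw [← ENNReal.ofReal_natCast]
              congr 1
              push_cast
              rw [show (4 : ℝ) = 2 * 2 by norm_num, mul_pow, mul_pow, ← pow_mul, ← pow_mul, ← pow_mul,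
                pow_mul, pow_mul, pow_mul, pow_succ]
              rw [mul_pow, ← pow_mul, ← pow_mul, mul_comm n q]
              ring
          _ ≤ _ := by
              refine ENNReal.ofReal_le_ofReal ?_
              have h1 : (1 : ℝ) ≤ (9 / 4) ^ n := one_le_pow₀ (by norm_num)
              have h2 : (1 : ℝ) ≤ y ^ 2 := one_le_pow₀ hy1
              have h3 : Real.exp (-(c * y ^ 2 * (9 / 4) ^ n)) ≤
                  Real.exp (-(c / 2 * y ^ 2)) * Real.exp (-(c / 2 * (9 / 4) ^ n)) := by
                rw [← Real.exp_add, Real.exp_le_exp]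
                -- For factors at least one, the product dominates the average; this separates the
                -- Gaussian decay in `y` from the summability in `n`.
                have h4 : y ^ 2 + (9 / 4 : ℝ) ^ n ≤ 2 * (y ^ 2 * (9 / 4) ^ n) := by
                  nlinarith [mul_nonneg (sub_nonneg.2 h1) (sub_nonneg.2 h2)]
                nlinarith [mul_le_mul_of_nonneg_left h4 hcpos.le]
              calc _ ≤ (2 : ℝ) ^ q * ((4 : ℝ) ^ q) ^ n * (Real.exp (-(c / 2 * y ^ 2)) *
                    Real.exp (-(c / 2 * (9 / 4) ^ n))) := by gcongr
                _ = _ := by ring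
    _ = ENNReal.ofReal (Real.exp (-(c / 2 * y ^ 2)) * S) := by
        rw [← ENNReal.ofReal_tsum_of_nonneg (fun n => by positivity) (hsum.mul_left _),
          tsum_mul_left]
    _ ≤ ENNReal.ofReal ((S + Real.exp (c / 2)) * Real.exp (-(c / 2 * y ^ 2))) := by
        refine ENNReal.ofReal_le_ofReal ?_
        rw [mul_comm]
        gcongr
        linarith [Real.exp_pos (c / 2)]

/-! ### Union over lattice cells and the Gaussian tail -/

theorem summable_int_exp_neg_sq {γ : ℝ} (hγ : 0 < γ) :
    Summable fun n : ℤ => Real.exp (-(γ * (n : ℝ) ^ 2)) := by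
  have h : Summable fun n : ℕ => Real.exp (-(γ * (n : ℝ) ^ 2)) := by
    refine Summable.of_nonneg_of_le (fun n => (Real.exp_pos _).le) (fun n => ?_)
      (Real.summable_exp_nat_mul_iff.2 (neg_lt_zero.2 hγ))
    rw [Real.exp_le_exp]
    have : (n : ℝ) ≤ (n : ℝ) ^ 2 := by exact_mod_cast Nat.le_self_pow two_ne_zero n
    nlinarith
  refine Summable.of_nat_of_neg (by simpa using h) (by simpa using h)

theorem summable_lattice_exp_neg_sq (q : ℕ) {γ : ℝ} (hγ : 0 < γ) :
    Summable fun k : Fin q → ℤ => Real.exp (-(γ * ∑ i, (k i : ℝ) ^ 2)) := by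
  have h1 := summable_int_exp_neg_sq hγ
  have e : ∀ k : Fin q → ℤ, Real.exp (-(γ * ∑ i, (k i : ℝ) ^ 2)) =
      ∏ i, Real.exp (-(γ * (k i : ℝ) ^ 2)) := fun k => by
    rw [← Real.exp_sum, Finset.mul_sum, Finset.sum_neg_distrib]
  simp_rw [e]
  refine summable_of_sum_le (c := ∏ _i : Fin q, ∑' n : ℤ, Real.exp (-(γ * (n : ℝ) ^ 2)))
    (fun k => by positivity) fun s => ?_
  calc ∑ k ∈ s, ∏ i, Real.exp (-(γ * (k i : ℝ) ^ 2))
      ≤ ∑ k ∈ Fintype.piFinset (fun i => Finset.image (fun k : Fin q → ℤ => k i) s),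
          ∏ i, Real.exp (-(γ * (k i : ℝ) ^ 2)) := by
        refine Finset.sum_le_sum_of_subset_of_nonneg (fun k hk => ?_) fun k _ _ => by positivity
        exact Fintype.mem_piFinset.2 fun i => Finset.mem_image_of_mem _ hk
    _ = ∏ i, ∑ n ∈ Finset.image (fun k : Fin q → ℤ => k i) s, Real.exp (-(γ * (n : ℝ) ^ 2)) :=
        (Finset.prod_univ_sum (fun i => Finset.image (fun k : Fin q → ℤ => k i) s)
          fun _ n => Real.exp (-(γ * (n : ℝ) ^ 2))).symm
    _ ≤ _ := by
        refine Finset.prod_le_prod (fun i _ => Finset.sum_nonneg fun n _ => by positivity)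
          fun i _ => ?_
        exact h1.sum_le_tsum _ fun n _ => by positivity

-- Expanding `(2N/5 − 4K)² / (2dN)` and dropping the `K²` term gives rate `2N/(25d)` with prefactor
-- `exp (8K/(5d))`. When the threshold is nonpositive, `N ≤ 10K` and the right side is at least one.
open ProbabilityTheory in
theorem measure_ge_le_of_hasSubgaussianMGF_mul {Ω : Type*} [MeasurableSpace Ω] {P : Measure Ω}
    [IsProbabilityMeasure P] {X : Ω → ℝ} {d N K : ℝ} (hd : 0 < d) (hK : 0 ≤ K)
    (h : HasSubgaussianMGF X (d * N).toNNReal P) :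
    P {ω | 2 / 5 * N - 4 * K ≤ X ω} ≤
      ENNReal.ofReal (Real.exp (8 * K / (5 * d)) * Real.exp (-(2 / 25 * N / d))) := by
  rw [← Real.exp_add]
  rcases le_or_gt (2 / 5 * N - 4 * K) 0 with hx | hx
  · refine prob_le_one.trans ?_
    rw [ENNReal.one_le_ofReal, Real.one_le_exp_iff]
    have : 8 * K / (5 * d) + -(2 / 25 * N / d) = (8 / 5 * K - 2 / 25 * N) / d := by
      field_simp; ring
    rw [this]
    exact div_nonneg (by linarith) hd.le
  · have hNpos : 0 < N := by linarith
    have ht := h.measure_ge_le hx.le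
    rw [Real.coe_toNNReal _ (by positivity)] at ht
    rw [← ENNReal.ofReal_toReal (measure_ne_top P _)]
    refine ENNReal.ofReal_le_ofReal (ht.trans (Real.exp_le_exp.2 ?_))
    rw [neg_div, neg_le]
    have e : -(8 * K / (5 * d) + -(2 / 25 * N / d)) =
        (4 / 25 * N ^ 2 - 16 / 5 * N * K) / (2 * (d * N)) := by
      field_simp; ring
    rw [e]
    gcongr
    nlinarith [sq_nonneg K]

open ProbabilityTheory in
/-- Gaussian tail for the location of the points where the linear term `2 Y` dominates `Φ(·, 0)`:
union over unit cells, a point bound in each cell, and chaining for the oscillation. -/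
theorem exists_contrast_tail {Ω : Type*} [MeasurableSpace Ω] (P : Measure Ω)
    [IsProbabilityMeasure P] (q : ℕ) {c₀ c₁ d : ℝ} (hc₀ : 0 < c₀) (hc₁ : 0 < c₁) (hd : 0 < d) :
    ∃ B : ℝ, 0 < B ∧ ∀ (U : Set (EuclideanSpace ℝ (Fin q)))
      (Y : EuclideanSpace ℝ (Fin q) → Ω → ℝ)
      (Φ : EuclideanSpace ℝ (Fin q) → EuclideanSpace ℝ (Fin q) → ℝ), 0 ∈ U →
      (∀ ω, Y 0 ω = 0) →
      (∀ u ∈ U, ∀ v ∈ U, ∀ w : NNReal, d * Φ u v ≤ w →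
        HasSubgaussianMGF (fun ω => Y u ω - Y v ω) w P) →
      (∀ u ∈ U, ∀ v ∈ U, c₀ * ‖u - v‖ ^ 2 ≤ Φ u v ∧ Φ u v ≤ c₁ * ‖u - v‖ ^ 2) →
      (∀ u ∈ U, ∀ v ∈ U, Φ v 0 ≤ 9 / 8 * Φ u 0 + 9 * Φ u v) →
      (∀ᵐ ω ∂P, ContinuousOn (fun u => Y u ω) U) →
      ∀ H : ℝ, 0 ≤ H → P {ω | ∃ u ∈ U, H ≤ ‖u‖ ∧ Φ u 0 ≤ 2 * Y u ω} ≤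
        ENNReal.ofReal (B * Real.exp (-(c₀ / (16 * d) * H ^ 2))) := by
  obtain ⟨C, c, hC, hc, hchain⟩ := exists_chaining_tail P q (mul_pos hd hc₁)
  set b : ℝ := c₀ / (16 * d) with hb
  have hbpos : 0 < b := by positivity
  -- Bound for `Φ(u, v)` within a unit cell, where `‖u − v‖² ≤ q`.
  set K : ℝ := c₁ * q with hK
  have hK0 : 0 ≤ K := by positivity
  set C₂ : ℝ := C * Real.exp (1 / (c * d ^ 2)) + Real.exp (8 * K / (5 * d)) with hC₂
  have hC₂pos : 0 < C₂ := by positivity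
  -- The point bound supplies the exponent `(2/25) N/d ≥ (32/25) b ‖v‖²`. Of this, `b ‖v‖²` covers
  -- `b H²`, and `(3/20) b ‖v‖²` pays for `(3/40) b ∑ kᵢ²`, up to the constant `(3/20) b q`, since
  -- `∑ kᵢ² ≤ 2‖v‖² + 2q`.
  have hsum := summable_lattice_exp_neg_sq q (γ := 3 / 40 * b) (by positivity)
  set S : ℝ := ∑' k : Fin q → ℤ, Real.exp (-(3 / 40 * b * ∑ i, (k i : ℝ) ^ 2)) with hS
  have hS0 : 0 ≤ S := tsum_nonneg fun k => by positivity
  set C₃ : ℝ := C₂ * Real.exp (b * (3 / 20 * q)) with hC₃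
  have hC₃pos : 0 < C₃ := by positivity
  refine ⟨C₃ * (S + 1), by positivity, ?_⟩
  intro U Y Φ h0U hY0 hsub hΦ htri hcont H hH
  have hcell : ∀ k : Fin q → ℤ,
      P {ω | ∃ u ∈ U, (∀ i, ⌊u i⌋ = k i) ∧ H ≤ ‖u‖ ∧ Φ u 0 ≤ 2 * Y u ω} ≤
      ENNReal.ofReal (C₃ * Real.exp (-(b * H ^ 2)) *
        Real.exp (-(3 / 40 * b * ∑ i, (k i : ℝ) ^ 2))) := by
    intro k
    by_cases hne : ∃ v ∈ U, (∀ i, ⌊v i⌋ = k i) ∧ H ≤ ‖v‖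
    swap
    · have : {ω | ∃ u ∈ U, (∀ i, ⌊u i⌋ = k i) ∧ H ≤ ‖u‖ ∧ Φ u 0 ≤ 2 * Y u ω} = ∅ := by
        ext ω
        simp only [mem_ofPred_eq, mem_empty_iff_false, iff_false]
        rintro ⟨u, hu, h1, h2, -⟩
        exact hne ⟨u, hu, h1, h2⟩
      rw [this, measure_empty]
      exact zero_le
    obtain ⟨v, hv, hvk, hvH⟩ := hne
    set N : ℝ := Φ v 0 with hN
    have hNv : c₀ * ‖v‖ ^ 2 ≤ N := by
      have := (hΦ v hv 0 h0U).1
      rwa [sub_zero] at this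
    have hN0 : 0 ≤ N := le_trans (by positivity) hNv
    set V : Set (EuclideanSpace ℝ (Fin q)) := {u | u ∈ U ∧ ∀ i, ⌊u i⌋ = k i} with hV
    have hdist : ∀ u ∈ V, Φ u v ≤ K := by
      intro u hu
      refine (hΦ u hu.1 v hv).2.trans ?_
      have := euclidean_norm_sq_le (x := u - v) (r := 1) (fun i => by
        have := abs_sub_le_of_floor_eq (n := 0) (x := u i) (y := v i) (by
          simp [hu.2 i, hvk i])
        simpa using this)
      rw [hK]
      gcongr
      simpa using this
    have hch := hchain V Y k v (fun u hu w hw z hz => hsub u hu.1 w hw.1 z (by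
        refine le_trans ?_ hz
        rw [mul_assoc]
        exact mul_le_mul_of_nonneg_left (hΦ u hu.1 w hw.1).2 hd.le))
      (hcont.mono fun ω hω => hω.mono fun u hu => hu.1) (fun u hu => hu.2) ⟨hv, hvk⟩ (N / 25)
      (by positivity)
    have hpt := measure_ge_le_of_hasSubgaussianMGF_mul (X := Y v) (N := N) hd hK0 (by
      have := hsub v hv 0 h0U (d * N).toNNReal (Real.le_coe_toNNReal _)
      simpa [hY0] using this)
    have hincl : {ω | ∃ u ∈ U, (∀ i, ⌊u i⌋ = k i) ∧ H ≤ ‖u‖ ∧ Φ u 0 ≤ 2 * Y u ω} ⊆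
        {ω | ∃ u ∈ V, N / 25 < Y u ω - Y v ω} ∪ {ω | 2 / 5 * N - 4 * K ≤ Y v ω} := by
      rintro ω ⟨u, hu, huk, -, huY⟩
      by_cases hlt : N / 25 < Y u ω - Y v ω
      · exact Or.inl ⟨u, ⟨hu, huk⟩, hlt⟩
      -- The triangle-type inequality gives `Φ(u,0) ≥ (8/9)N − 8K`, hence `Y(u) ≥ (4/9)N − 4K`;
      -- subtracting the oscillation `N/25` still leaves at least `(2/5)N − 4K`.
      · right
        have h1 := htri u hu v hv
        have h2 := hdist u ⟨hu, huk⟩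
        simp only [mem_ofPred_eq]
        linarith
    have hexp : C₂ * Real.exp (-(2 / 25 * N / d)) ≤ C₃ * Real.exp (-(b * H ^ 2)) *
        Real.exp (-(3 / 40 * b * ∑ i, (k i : ℝ) ^ 2)) := by
      rw [hC₃, mul_assoc, mul_assoc, ← Real.exp_add, ← Real.exp_add]
      gcongr
      have h1 : H ^ 2 ≤ ‖v‖ ^ 2 := pow_le_pow_left₀ hH hvH 2
      have h2 : ∑ i, (k i : ℝ) ^ 2 ≤ 2 * ‖v‖ ^ 2 + 2 * q := by
        rw [EuclideanSpace.norm_sq_eq, Finset.mul_sum]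
        calc ∑ i, (k i : ℝ) ^ 2 ≤ ∑ i : Fin q, (2 * ‖v i‖ ^ 2 + 2) := by
              refine Finset.sum_le_sum fun i _ => ?_
              have h3 := Int.floor_eq_iff.1 (hvk i)
              rw [Real.norm_eq_abs, sq_abs]
              nlinarith [sq_nonneg ((k i : ℝ) - 2 * v i), sq_nonneg ((k i : ℝ) - v i),
                sq_nonneg (2 * (v i) - k i)]
          _ = _ := by rw [Finset.sum_add_distrib]; simp [mul_comm]
      have h4 : 2 / 25 * N / d ≥ 32 / 25 * b * ‖v‖ ^ 2 := by
        have : 32 / 25 * b * ‖v‖ ^ 2 = 2 / 25 * (c₀ * ‖v‖ ^ 2) / d := by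
          rw [hb]; field_simp; ring
        rw [this]
        gcongr
      have h5 := mul_le_mul_of_nonneg_left h2 hbpos.le
      have h6 := mul_le_mul_of_nonneg_left h1 hbpos.le
      have h7 : 0 ≤ b * ‖v‖ ^ 2 := by positivity
      have h8 : 0 ≤ b * (q : ℝ) := by positivity
      nlinarith
    calc _ ≤ P ({ω | ∃ u ∈ V, N / 25 < Y u ω - Y v ω} ∪ {ω | 2 / 5 * N - 4 * K ≤ Y v ω}) :=
          measure_mono hincl
      _ ≤ _ := measure_union_le _ _
      _ ≤ ENNReal.ofReal (C * Real.exp (-(c * (N / 25) ^ 2))) +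
          ENNReal.ofReal (Real.exp (8 * K / (5 * d)) * Real.exp (-(2 / 25 * N / d))) :=
          add_le_add hch hpt
      _ = ENNReal.ofReal (C * Real.exp (-(c * (N / 25) ^ 2)) +
          Real.exp (8 * K / (5 * d)) * Real.exp (-(2 / 25 * N / d))) :=
          (ENNReal.ofReal_add (by positivity) (by positivity)).symm
      _ ≤ ENNReal.ofReal (C₂ * Real.exp (-(2 / 25 * N / d))) := by
          refine ENNReal.ofReal_le_ofReal ?_
          rw [hC₂, add_mul, mul_assoc C, ← Real.exp_add (1 / (c * d ^ 2))]
          gcongr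
          -- Completing the square in `N`: the quadratic chaining exponent dominates the linear
          -- point exponent up to the factor `exp (1/(c d²))`.
          have : 1 / (c * d ^ 2) + -(2 / 25 * N / d) - -(c * (N / 25) ^ 2) =
              (c * N / 25 - 1 / d) ^ 2 / c := by
            field_simp; ring
          have h2 : 0 ≤ (c * N / 25 - 1 / d) ^ 2 / c := by positivity
          linarith
      _ ≤ _ := ENNReal.ofReal_le_ofReal hexp
  calc P {ω | ∃ u ∈ U, H ≤ ‖u‖ ∧ Φ u 0 ≤ 2 * Y u ω}
      ≤ P (⋃ k : Fin q → ℤ,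
          {ω | ∃ u ∈ U, (∀ i, ⌊u i⌋ = k i) ∧ H ≤ ‖u‖ ∧ Φ u 0 ≤ 2 * Y u ω}) := by
        refine measure_mono ?_
        rintro ω ⟨u, hu, h1, h2⟩
        exact mem_iUnion.2 ⟨fun i => ⌊u i⌋, u, hu, fun i => rfl, h1, h2⟩
    _ ≤ _ := measure_iUnion_le _
    _ ≤ ∑' k : Fin q → ℤ, ENNReal.ofReal (C₃ * Real.exp (-(b * H ^ 2)) *
        Real.exp (-(3 / 40 * b * ∑ i, (k i : ℝ) ^ 2))) := ENNReal.tsum_le_tsum hcell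
    _ = ENNReal.ofReal (C₃ * Real.exp (-(b * H ^ 2)) * S) := by
        rw [← ENNReal.ofReal_tsum_of_nonneg (fun k => by positivity) (hsum.mul_left _),
          tsum_mul_left]
    _ ≤ _ := by
        refine ENNReal.ofReal_le_ofReal ?_
        rw [mul_right_comm]
        gcongr
        linarith

/-! ### Normalization, least squares inequality and tail of the estimator -/

section
variable {q : ℕ}

theorem diagMul_inv_diagMul {s : Fin q → ℝ} (hs : ∀ i, 0 < s i) (x : EuclideanSpace ℝ (Fin q)) :
    diagMul (fun i => (s i)⁻¹) (diagMul s x) = x := by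
  ext i
  simp [diagMul, inv_mul_cancel_left₀ (hs i).ne']

theorem diagMul_zero (s : Fin q → ℝ) : diagMul s 0 = 0 := by
  ext i
  simp [diagMul]

theorem continuous_diagMul (s : Fin q → ℝ) : Continuous (diagMul s) :=
  (PiLp.continuous_toLp 2 _).comp (by fun_prop)

theorem mul_norm_le_norm_diagMul {s : Fin q → ℝ} {c : ℝ} (hc : 0 ≤ c) (hs : ∀ i, c ≤ s i)
    (x : EuclideanSpace ℝ (Fin q)) : c * ‖x‖ ≤ ‖diagMul s x‖ := by
  refine (sq_le_sq₀ (by positivity) (norm_nonneg _)).1 ?_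
  rw [mul_pow, EuclideanSpace.norm_sq_eq, EuclideanSpace.norm_sq_eq, Finset.mul_sum]
  refine Finset.sum_le_sum fun i _ => ?_
  simp only [diagMul, norm_mul, mul_pow, Real.norm_eq_abs, sq_abs]
  have := pow_le_pow_left₀ hc (hs i) 2
  gcongr

/-- There are finitely many coordinates, so one constant below all the individual lower bounds
works; choosing it as a small positive number also covers `q = 0`. -/
theorem exists_le_of_liminf_pos {s : ℝ → Fin q → ℝ}
    (h : ∀ i, 0 < liminf (fun T : ℝ => ((T ^ (-(1 / 2) : ℝ) * s T i : ℝ) : EReal)) atTop) :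
    ∃ c : ℝ, 0 < c ∧ ∃ T₀ : ℝ, ∀ T, T₀ < T → ∀ i, c * Real.sqrt T ≤ s T i := by
  have h1 : ∀ i, ∃ c : ℝ, 0 < c ∧ ∀ᶠ T : ℝ in atTop, c < T ^ (-(1 / 2) : ℝ) * s T i := by
    intro i
    obtain ⟨c, hc0, hc⟩ := EReal.lt_iff_exists_real_btwn.1 (h i)
    refine ⟨c, by exact_mod_cast hc0, ?_⟩
    filter_upwards [eventually_lt_of_lt_liminf hc] with T hT
    exact_mod_cast hT
  choose c hc0 hc using h1
  have h2 : ∀ᶠ r : ℝ in 𝓝[>] 0, ∀ i, r < c i := eventually_all.2 fun i =>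
    mem_nhdsWithin_of_mem_nhds (Iio_mem_nhds (hc0 i))
  obtain ⟨r, hr, hr0⟩ := (h2.and self_mem_nhdsWithin).exists
  refine ⟨r, hr0, ?_⟩
  obtain ⟨T₀, hT₀⟩ := eventually_atTop.1 (eventually_all.2 hc)
  refine ⟨max T₀ 0, fun T hT i => ?_⟩
  have hTpos : 0 < T := (le_max_right _ _).trans_lt hT
  have h3 := (hr i).trans (hT₀ T ((le_max_left _ _).trans hT.le) i)
  rw [Real.rpow_neg hTpos.le, ← Real.sqrt_eq_rpow, inv_mul_eq_div,
    lt_div_iff₀ (Real.sqrt_pos.2 hTpos)] at h3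
  exact h3.le

end

section
variable {Ω : Type*} [MeasurableSpace Ω] {P : Measure Ω} {q : ℕ}
  {Θ : Set (EuclideanSpace ℝ (Fin q))} {a : ℝ → EuclideanSpace ℝ (Fin q) → ℝ}

theorem IsRegressionModel.continuousOn_time (ha : IsRegressionModel Θ a)
    {τ : EuclideanSpace ℝ (Fin q)} (hτ : τ ∈ closure Θ) (T : ℝ) :
    ContinuousOn (fun t => a t τ) (Icc 0 T) :=
  ha.continuousOn.comp (f := fun t : ℝ => (t, τ)) (by fun_prop) fun _ ht => ⟨ht.1, hτ⟩

theorem IsRegressionModel.continuousOn_integral (ha : IsRegressionModel Θ a) {x : ℝ → ℝ}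
    (hx : Continuous x) {T : ℝ} (hT : 0 < T) {b : ℝ → ℝ} (hb : ContinuousOn b (Icc 0 T)) :
    ContinuousOn (fun τ => ∫ t in (0 : ℝ)..T, x t * (a t τ - b t)) (closure Θ) := by
  have hK : IsCompact (Icc 0 T ×ˢ closure Θ) :=
    isCompact_Icc.prod (Metric.isCompact_of_isClosed_isBounded isClosed_closure
      ha.isBounded.closure)
  have hc : ContinuousOn (fun p : ℝ × EuclideanSpace ℝ (Fin q) => x p.1 * (a p.1 p.2 - b p.1))
      (Icc 0 T ×ˢ closure Θ) :=
    (hx.comp continuous_fst).continuousOn.mul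
      ((ha.continuousOn.mono (prod_mono_left Icc_subset_Ici_self)).sub
        (hb.comp continuousOn_fst fun p hp => hp.1))
  obtain ⟨M, hM⟩ := hK.exists_bound_of_continuousOn hc
  have hI : uIoc 0 T ⊆ Icc 0 T := by
    rw [uIoc_of_le hT.le]; exact Ioc_subset_Icc_self
  intro τ hτ
  refine intervalIntegral.tendsto_integral_filter_of_dominated_convergence (fun _ => M) ?_ ?_ ?_ ?_
  · filter_upwards [self_mem_nhdsWithin] with σ hσ
    exact ((hx.continuousOn.mul ((ha.continuousOn_time hσ T).sub hb)).mono hI).aestronglyMeasurable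
      measurableSet_uIoc
  · filter_upwards [self_mem_nhdsWithin] with σ hσ
    exact Eventually.of_forall fun t ht => hM (t, σ) ⟨hI ht, hσ⟩
  · exact intervalIntegrable_const
  · refine Eventually.of_forall fun t ht => ?_
    have h1 : ContinuousOn (fun σ => x t * (a t σ - b t)) (closure Θ) :=
      hc.comp (f := fun σ => (t, σ)) (by fun_prop) fun σ hσ => ⟨hI ht, hσ⟩
    exact h1 τ hτ

/-- Expand the square around the true signal: the pure noise terms cancel, leaving the signal
distance against twice the linear noise term. -/
theorem integral_sq_sub_le_of_contrast_le {x f g : ℝ → ℝ} {T : ℝ} (hT : 0 < T)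
    (hx : ContinuousOn x (Icc 0 T)) (hf : ContinuousOn f (Icc 0 T))
    (hg : ContinuousOn g (Icc 0 T))
    (h : ∫ t in (0 : ℝ)..T, (f t + x t - g t) ^ 2 ≤ ∫ t in (0 : ℝ)..T, (f t + x t - f t) ^ 2) :
    ∫ t in (0 : ℝ)..T, (g t - f t) ^ 2 ≤ 2 * ∫ t in (0 : ℝ)..T, x t * (g t - f t) := by
  have hi : ∀ F : ℝ → ℝ, ContinuousOn F (Icc 0 T) → IntervalIntegrable F volume 0 T :=
    fun F hF => ContinuousOn.intervalIntegrable (by rwa [uIcc_of_le hT.le])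
  have e : ∫ t in (0 : ℝ)..T, (f t + x t - g t) ^ 2 = (∫ t in (0 : ℝ)..T, (f t + x t - f t) ^ 2) -
      2 * (∫ t in (0 : ℝ)..T, x t * (g t - f t)) + ∫ t in (0 : ℝ)..T, (g t - f t) ^ 2 := by
    rw [← intervalIntegral.integral_const_mul, ← intervalIntegral.integral_sub,
      ← intervalIntegral.integral_add]
    · refine intervalIntegral.integral_congr fun t _ => ?_
      ring
    · exact hi _ (by fun_prop)
    · exact hi _ (by fun_prop)
    · exact hi _ (by fun_prop)
    · exact hi _ (by fun_prop)
  linarith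

/-- Young's inequality with parameter `1/8`. A factor this close to one is needed in front of the
first term, since it eats directly into the exponential rate. -/
theorem integral_sq_le_of_sub {f g h : ℝ → ℝ} {T : ℝ} (hT : 0 < T)
    (hf : ContinuousOn f (Icc 0 T)) (hg : ContinuousOn g (Icc 0 T))
    (hh : ContinuousOn h (Icc 0 T)) :
    ∫ t in (0 : ℝ)..T, (g t - h t) ^ 2 ≤ 9 / 8 * (∫ t in (0 : ℝ)..T, (f t - h t) ^ 2) +
      9 * ∫ t in (0 : ℝ)..T, (f t - g t) ^ 2 := by
  have hi : ∀ F : ℝ → ℝ, ContinuousOn F (Icc 0 T) → IntervalIntegrable F volume 0 T :=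
    fun F hF => ContinuousOn.intervalIntegrable (by rwa [uIcc_of_le hT.le])
  rw [← intervalIntegral.integral_const_mul, ← intervalIntegral.integral_const_mul,
    ← intervalIntegral.integral_add (hi _ (by fun_prop)) (hi _ (by fun_prop))]
  refine intervalIntegral.integral_mono_on hT.le (hi _ (by fun_prop)) (hi _ (by fun_prop))
    fun t _ => ?_
  nlinarith [sq_nonneg ((f t - h t) + 8 * (f t - g t))]

/-- Gaussian tail bound for the normalized least squares estimator. -/
theorem exists_tail_bound [IsProbabilityMeasure P] (ha : IsRegressionModel Θ a)
    {θ : EuclideanSpace ℝ (Fin q)} (hθ : θ ∈ Θ) {ε : ℝ → Ω → ℝ}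
    (hε : IsContinuousCentredNoise P ε) {d₀ d : ℝ} (hnoise : NoiseCondition P ε d₀)
    (hd : 0 < d) (hd₀ : d₀ ≤ d) {s : ℝ → Fin q → ℝ} {c₀ c₁ : ℝ}
    (hR : IsIdentifiable Θ a s θ c₀ c₁) {T₁ : ℝ} (hs : ∀ T, T₁ < T → ∀ i, 0 < s T i) :
    ∃ B T₀ : ℝ, 0 < B ∧ ∀ θhat : ℝ → Ω → EuclideanSpace ℝ (Fin q), IsLSE P Θ a θ ε θhat →
      ∀ T, T₀ < T → ∀ H : ℝ, 0 ≤ H →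
        P.real {ω | H ≤ ‖diagMul (s T) (θhat T ω - θ)‖} ≤
          B * Real.exp (-(c₀ / (16 * d) * H ^ 2)) := by
  obtain ⟨hc₀, hc₁, T₂, hΦ⟩ := hR
  obtain ⟨B, hB, hmain⟩ := exists_contrast_tail P q hc₀ (hc₀.trans hc₁) hd
  refine ⟨B, max (max T₁ T₂) 0, hB, fun θhat hLSE T hT H hH => ?_⟩
  have hT0 : 0 < T := (le_max_right _ _).trans_lt hT
  have hTs := hs T ((le_max_left _ _).trans_lt ((le_max_left _ _).trans_lt hT))
  have hTΦ := hΦ T ((le_max_right _ _).trans_lt ((le_max_left _ _).trans_lt hT))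
  have hθc : θ ∈ closure Θ := subset_closure hθ
  set p : EuclideanSpace ℝ (Fin q) → EuclideanSpace ℝ (Fin q) :=
    fun u => θ + diagMul (fun i => (s T i)⁻¹) u with hp
  have hpτ : ∀ τ, p (diagMul (s T) (τ - θ)) = τ := fun τ => by
    rw [hp]; simp only; rw [diagMul_inv_diagMul hTs, add_sub_cancel]
  have hp0 : p 0 = θ := by rw [hp]; simp only; rw [diagMul_zero, add_zero]
  have hpU : ∀ u ∈ normedSet Θ s θ T, p u ∈ closure Θ := by
    rintro _ ⟨τ, hτ, rfl⟩
    simp only; rwa [hpτ]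
  have hA : ∀ u ∈ normedSet Θ s θ T, ContinuousOn (fun t => a t (p u)) (Icc 0 T) :=
    fun u hu => ha.continuousOn_time (hpU u hu) T
  have h0U : (0 : EuclideanSpace ℝ (Fin q)) ∈ normedSet Θ s θ T :=
    ⟨θ, hθc, by simp only [sub_self, diagMul_zero]⟩
  have hi : ∀ F : ℝ → ℝ, ContinuousOn F (Icc 0 T) → IntervalIntegrable F volume 0 T :=
    fun F hF => ContinuousOn.intervalIntegrable (by rwa [uIcc_of_le hT0.le])
  set Y : EuclideanSpace ℝ (Fin q) → Ω → ℝ :=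
    fun u ω => ∫ t in (0 : ℝ)..T, ε t ω * (a t (p u) - a t (p 0)) with hY
  have htail := hmain (normedSet Θ s θ T) Y (Phi a s θ T) h0U (fun ω => by simp [hY])
    (fun u hu v hv w hw => by
      have hΔ : ContinuousOn (fun t => a t (p u) - a t (p v)) (Icc 0 T) := (hA u hu).sub (hA v hv)
      have hnn : 0 ≤ Phi a s θ T u v :=
        intervalIntegral.integral_nonneg hT0.le fun t _ => sq_nonneg _
      refine (hnoise.hasSubgaussianMGF_integral hε hT0 hΔ
        ((mul_le_mul_of_nonneg_right hd₀ hnn).trans hw)).congr ?_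
      filter_upwards [hε.ae_continuous] with ω hω
      have hω' := hω.continuousOn (s := Icc 0 T)
      rw [hY]
      simp only
      have h1 := hA u hu
      have h2 := hA v hv
      have h3 := hA 0 h0U
      rw [← intervalIntegral.integral_sub (hi _ (by fun_prop)) (hi _ (by fun_prop))]
      refine intervalIntegral.integral_congr fun t _ => ?_
      ring)
    hTΦ
    (fun u hu v hv => integral_sq_le_of_sub hT0 (hA u hu) (hA v hv) (hA 0 h0U))
    (by
      filter_upwards [hε.ae_continuous] with ω hω
      refine (ha.continuousOn_integral hω hT0 (hA 0 h0U)).comp (f := p) ?_ hpU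
      exact (continuous_const.add (continuous_diagMul _)).continuousOn)
    H hH
  refine ENNReal.toReal_le_of_le_ofReal (by positivity) (le_trans (measure_mono_ae ?_) htail)
  filter_upwards [hε.ae_continuous, (hLSE T hT0).2] with ω hω hmin
  intro hHω
  have hu : diagMul (s T) (θhat T ω - θ) ∈ normedSet Θ s θ T := ⟨_, hmin.1, rfl⟩
  -- The normalized error itself is the witness. The containment only has to hold almost surely, and
  -- the event of a witness existing needs no measurability, since only its outer measure is
  -- bounded.
  refine ⟨_, hu, hHω, ?_⟩
  have h1 : contrast a (fun t => a t θ + ε t ω) T (θhat T ω) ≤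
      contrast a (fun t => a t θ + ε t ω) T θ := hmin.2 hθc
  have h2 := integral_sq_sub_le_of_contrast_le hT0 hω.continuousOn (ha.continuousOn_time hθc T)
    (ha.continuousOn_time hmin.1 T) h1
  have e1 : Phi a s θ T (diagMul (s T) (θhat T ω - θ)) 0 =
      ∫ t in (0 : ℝ)..T, (a t (θhat T ω) - a t θ) ^ 2 := by
    change ∫ t in (0 : ℝ)..T, (a t (p _) - a t (p 0)) ^ 2 = _
    rw [hpτ, hp0]
  have e2 : Y (diagMul (s T) (θhat T ω - θ)) ω =
      ∫ t in (0 : ℝ)..T, ε t ω * (a t (θhat T ω) - a t θ) := by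
    rw [hY]; simp only
    rw [hpτ, hp0]
  rw [e1, e2]
  exact h2

theorem exists_tail_bound_with_rate [IsProbabilityMeasure P] (ha : IsRegressionModel Θ a)
    {θ : EuclideanSpace ℝ (Fin q)} (hθ : θ ∈ Θ) {ε : ℝ → Ω → ℝ}
    (hε : IsContinuousCentredNoise P ε) {d₀ : ℝ} (hnoise : NoiseCondition P ε d₀)
    {s : ℝ → Fin q → ℝ} {c₀ c₁ : ℝ}
    (hR : IsIdentifiable Θ a s θ c₀ c₁) {T₁ : ℝ} (hs : ∀ T, T₁ < T → ∀ i, 0 < s T i) :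
    ∃ B b T₀ : ℝ, 0 < B ∧ 0 < b ∧ c₀ / (8 * d₀ * (1 + q)) ≤ b ∧
      ∀ θhat : ℝ → Ω → EuclideanSpace ℝ (Fin q), IsLSE P Θ a θ ε θhat →
      ∀ T, T₀ < T → ∀ H : ℝ, 0 < H →
        P.real {ω | H ≤ ‖diagMul (s T) (θhat T ω - θ)‖} ≤ B * Real.exp (-(b * H ^ 2)) := by
  have hc₀ := hR.1
  rcases Nat.eq_zero_or_pos q with rfl | hq
  -- In dimension zero the error vanishes, so the event is empty for `H > 0` and any rate is
  -- admissible.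
  · refine ⟨1, max 1 (c₀ / (8 * d₀ * (1 + (0 : ℕ)))), 0, one_pos, by positivity, le_max_right _ _,
      fun θhat _ T _ H hH => ?_⟩
    have : {ω | H ≤ ‖diagMul (s T) (θhat T ω - θ)‖} = ∅ := by
      ext ω
      simp only [mem_ofPred_eq, mem_empty_iff_false, iff_false, not_le]
      rwa [Subsingleton.elim (diagMul (s T) (θhat T ω - θ)) 0, norm_zero]
    rw [this, measureReal_empty]
    positivity
  · have hd₀ := hnoise.nonneg
    obtain ⟨d, hd, hdd, hle⟩ : ∃ d : ℝ, 0 < d ∧ d₀ ≤ d ∧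
        c₀ / (8 * d₀ * (1 + q)) ≤ c₀ / (16 * d) := by
      rcases hd₀.eq_or_lt with h | h
      -- With `d₀ = 0` the required rate is zero under the convention for division, so any positive
      -- variance constant will do.
      · exact ⟨1, one_pos, by rw [← h]; exact zero_le_one, by rw [← h]; simp; positivity⟩
      · refine ⟨d₀, h, le_rfl, ?_⟩
        have : (1 : ℝ) ≤ q := by exact_mod_cast hq
        refine div_le_div_of_nonneg_left hc₀.le (by positivity) ?_
        nlinarith
    obtain ⟨B, T₀, hB, h⟩ := exists_tail_bound ha hθ hε hnoise hd hdd hR hs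
    exact ⟨B, c₀ / (16 * d), T₀, hB, by positivity, hle,
      fun θhat hLSE T hT H hH => h θhat hLSE T hT H hH.le⟩
end

end RegressionLSE

end

/-! ### The three deviation bounds -/

open RegressionLSE
theorem corollary5 {Ω : Type*} [MeasurableSpace Ω] (P : Measure Ω) [IsProbabilityMeasure P]
    {q : ℕ} (Θ : Set (EuclideanSpace ℝ (Fin q))) (a : ℝ → EuclideanSpace ℝ (Fin q) → ℝ)
    (ha : IsRegressionModel Θ a)
    (θ : EuclideanSpace ℝ (Fin q)) (hθ : θ ∈ Θ)
    (ε : ℝ → Ω → ℝ) (hε : IsContinuousCentredNoise P ε)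
    (d₀ : ℝ) (hnoise : NoiseCondition P ε d₀)
    (s : ℝ → Fin q → ℝ) (hs : IsNormalization Θ a s)
    (c₀ c₁ : ℝ) (hR : IsIdentifiable Θ a s θ c₀ c₁)
    (hliminf : ∀ i, 0 < liminf (fun T : ℝ => ((T ^ (-(1 / 2) : ℝ) * s T i : ℝ) : EReal)) atTop)
    (β : ℝ) (hβ : 0 < β) :
    ∃ B b κ T₀ : ℝ, 0 < B ∧ 0 < b ∧ 0 < κ ∧ 0 < T₀ ∧ c₀ / (8 * d₀ * (1 + q)) - β ≤ b ∧
      ∀ θhat : ℝ → Ω → EuclideanSpace ℝ (Fin q), IsLSE P Θ a θ ε θhat → ∀ T : ℝ, T₀ < T →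
        (∀ ρ ν : ℝ, 0 < ρ → 0 ≤ ν → ν < 1 / 2 →
          P.real {ω | ρ * T ^ (-ν) ≤
              ‖T ^ (-(1 / 2) : ℝ) • diagMul (s T) (θhat T ω - θ)‖} ≤
            B * Real.exp (-(b * ρ ^ 2 * T ^ (1 - 2 * ν)))) ∧
        (∀ h : ℝ, 0 < h →
          P.real {ω | h * Real.sqrt (Real.log T) ≤ ‖diagMul (s T) (θhat T ω - θ)‖} ≤
            B * T ^ (-(b * h ^ 2))) ∧
        (∀ r : ℝ, 0 < r →
          P.real {ω | r ≤ ‖θhat T ω - θ‖} ≤ B * Real.exp (-(κ * r ^ 2 * T))) := by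
  obtain ⟨c, hc, T₁, hT₁⟩ := exists_le_of_liminf_pos hliminf
  have hspos : ∀ T, max T₁ 0 < T → ∀ i, 0 < s T i := fun T hT i => by
    have hT0 : 0 < T := (le_max_right _ _).trans_lt hT
    exact (mul_pos hc (Real.sqrt_pos.2 hT0)).trans_le (hT₁ T ((le_max_left _ _).trans_lt hT) i)
  obtain ⟨B, b, T₂, hB, hb, hbc, htail⟩ :=
    exists_tail_bound_with_rate ha hθ hε hnoise hR hspos
  -- Taking `T > 1` makes `log T` positive, so the moderate deviation level is a positive `H`. The
  -- value of `κ` comes from `H = c √T r`.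
  refine ⟨B, b, b * c ^ 2, max (max T₁ T₂) 1, hB, hb, by positivity,
    one_pos.trans_le (le_max_right _ _), by linarith, fun θhat hLSE T hT => ?_⟩
  have hT1 : 1 < T := (le_max_right _ _).trans_lt hT
  have hTpos : 0 < T := one_pos.trans hT1
  have hTs := hT₁ T ((le_max_left _ _).trans_lt ((le_max_left _ _).trans_lt hT))
  have ht := htail θhat hLSE T ((le_max_right _ _).trans_lt ((le_max_left _ _).trans_lt hT))
  refine ⟨fun ρ ν hρ _ _ => ?_, fun h hh => ?_, fun r hr => ?_⟩
  · have h1 := ht (ρ * T ^ (1 / 2 - ν)) (by positivity)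
    have e1 : {ω | ρ * T ^ (-ν) ≤ ‖T ^ (-(1 / 2) : ℝ) • diagMul (s T) (θhat T ω - θ)‖} =
        {ω | ρ * T ^ (1 / 2 - ν) ≤ ‖diagMul (s T) (θhat T ω - θ)‖} := by
      ext ω
      simp only [mem_ofPred_eq]
      rw [norm_smul, Real.norm_of_nonneg (by positivity), Real.rpow_neg hTpos.le (1 / 2),
        inv_mul_eq_div, le_div_iff₀ (by positivity), mul_assoc, ← Real.rpow_add hTpos,
        neg_add_eq_sub]
    have e2 : b * (ρ * T ^ (1 / 2 - ν)) ^ 2 = b * ρ ^ 2 * T ^ (1 - 2 * ν) := by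
      rw [mul_pow, ← Real.rpow_natCast (T ^ (1 / 2 - ν)), ← Real.rpow_mul hTpos.le, mul_assoc]
      congr 3
      push_cast; ring
    rwa [e1, ← e2]
  · have hlog := Real.log_pos hT1
    have h1 := ht (h * Real.sqrt (Real.log T)) (mul_pos hh (Real.sqrt_pos.2 hlog))
    rw [mul_pow, Real.sq_sqrt hlog.le] at h1
    rw [Real.rpow_def_of_pos hTpos]
    convert h1 using 3
    ring
  · have h1 := ht (c * Real.sqrt T * r) (by positivity)
    refine (measureReal_mono ?_ (measure_ne_top _ _)).trans (h1.trans (le_of_eq ?_))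
    · intro ω hω
      exact (mul_le_mul_of_nonneg_left hω (by positivity)).trans
        (mul_norm_le_norm_diagMul (by positivity) hTs _)
    · rw [mul_pow, mul_pow, Real.sq_sqrt hTpos.le]
      congr 3
      ring
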